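/- An instance $I=(G,N,\mathcal U)$ of connected fair division consists of an undirected graph $G=(V,E)$ whose vertices are the items, a set of players $N=\{1,\dots,n\}$, and utility functions $u_i:V\to\mathbb{Q}_{\ge 0}$ with $\sum_{v\in V}u_i(v)=1$ for each $i\in N$; for $X\subseteq V$ put $u_i(X)=\sum_{v\in X}u_i(v)$. An allocation $\pi:N\to 2^V$ is valid if every bundle $\pi(i)$ is connected in $G$ (the empty bundle is allowed) and $\pi(i)\cap\pi(j)=\emptyset$ for all $i\ne j$; it is proportional if $u_i(\pi(i))\ge \frac1n$ for all $i\in N$. The problem Prop-CFD asks whether a given instance admits a proportional valid allocation. Write $|I|$ for the length of the encoding of $I$ in which the graph is given by its adjacency matrix and the numerators and denominators of the utilities are written in binary. **Theorem.** Prop-CFD restricted to instances in which $G$ is a tree is fixed-parameter tractable with respect to the number of players $n$: there are a single algorithm (a random access machine program, with running time measured by logarithmic cost), a function $f:\mathbb N\to\mathbb N$ and a polynomial $q$ such that for every instance $I$ with $n$ players whose graph is a tree, the algorithm halts after time at most $f(n)\cdot q(|I|)$ and answers correctly whether $I$ admits a proportional valid allocation. -/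

import Mathlib

/-! ### Connected fair division -/

/-- An instance of connected fair division with rational utilities: the items are the vertices
`Fin m` of a graph, the players are `Fin n`. -/
structure CFD where
  n : ℕ
  m : ℕ
  graph : SimpleGraph (Fin m)
  util : Fin n → Fin m → ℚ
  util_nonneg : ∀ i v, 0 ≤ util i v
  util_sum : ∀ i, ∑ v, util i v = 1

namespace CFD

/-- Additive utility of a bundle. -/
def bundleUtil (I : CFD) (i : Fin I.n) (X : Finset (Fin I.m)) : ℚ :=
  ∑ v ∈ X, I.util i v

/-- Every bundle is connected (possibly empty) and no item is allocated twice. -/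
def Valid (I : CFD) (π : Fin I.n → Finset (Fin I.m)) : Prop :=
  (∀ i, (I.graph.induce (π i : Set (Fin I.m))).Preconnected) ∧
    ∀ i j, i ≠ j → Disjoint (π i) (π j)

def Proportional (I : CFD) (π : Fin I.n → Finset (Fin I.m)) : Prop :=
  ∀ i, (1 : ℚ) / (I.n : ℚ) ≤ I.bundleUtil i (π i)

/-- The question of Prop-CFD: is there a proportional valid allocation? -/
def HasPropAllocation (I : CFD) : Prop :=
  ∃ π : Fin I.n → Finset (Fin I.m), I.Valid π ∧ I.Proportional π

open Classical in
/-- The input word: `n`, `m`, the adjacency matrix row by row, and then, player by player and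
item by item, numerator and denominator of the utility in lowest terms. -/
noncomputable def encode (I : CFD) : List ℕ :=
  [I.n, I.m] ++
    ((List.finRange I.m).flatMap fun v =>
      (List.finRange I.m).map fun w => if I.graph.Adj v w then 1 else 0) ++
    ((List.finRange I.n).flatMap fun i =>
      (List.finRange I.m).flatMap fun v => [(I.util i v).num.toNat, (I.util i v).den])

end CFD

/-! ### Random access machines with logarithmic cost -/

namespace RAM

/-- Programs of a random access machine, in structured form. A cell index written in the program
is a direct address; `load` and `store` use indirect addresses. -/
inductive Prog : Type
  | skip
  | const (r c : ℕ)
  | copy (r a : ℕ)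
  | add (r a b : ℕ)
  | sub (r a b : ℕ)
  | mul (r a b : ℕ)
  | div (r a b : ℕ)
  | load (r a : ℕ)
  | store (a b : ℕ)
  | read (r : ℕ)
  | seq (p q : Prog)
  | ite (a : ℕ) (p q : Prog)
  | while (a : ℕ) (p : Prog)

/-- The memory, and the part of the input tape that has not been read yet. -/
structure State where
  mem : ℕ → ℕ
  input : List ℕ

/-- Assignment of a value to a memory cell. -/
def State.set (s : State) (r x : ℕ) : State :=
  { s with mem := Function.update s.mem r x }

/-- Initially all cells are zero and the whole input is on the tape. -/
def start (w : List ℕ) : State where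
  mem := fun _ => 0
  input := w

/-- Logarithmic cost of a natural number: its number of binary digits, plus one. -/
def lc (x : ℕ) : ℕ := Nat.size x + 1

/-- Cost of using the cell `a` as an operand: its address and its content. -/
def State.opCost (s : State) (a : ℕ) : ℕ := lc a + lc (s.mem a)

/-- `Exec p s t s'`: started in the state `s`, the program `p` halts in the state `s'`, and the
total logarithmic cost of the run is `t`. -/
inductive Exec : Prog → State → ℕ → State → Prop
  | skip (s : State) : Exec .skip s 1 s
  | const (r c : ℕ) (s : State) :
      Exec (.const r c) s (lc r + lc c) (s.set r c)
  | copy (r a : ℕ) (s : State) :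
      Exec (.copy r a) s (lc r + s.opCost a) (s.set r (s.mem a))
  | add (r a b : ℕ) (s : State) :
      Exec (.add r a b) s (lc r + s.opCost a + s.opCost b) (s.set r (s.mem a + s.mem b))
  /-- truncated subtraction -/
  | sub (r a b : ℕ) (s : State) :
      Exec (.sub r a b) s (lc r + s.opCost a + s.opCost b) (s.set r (s.mem a - s.mem b))
  | mul (r a b : ℕ) (s : State) :
      Exec (.mul r a b) s (lc r + s.opCost a + s.opCost b) (s.set r (s.mem a * s.mem b))
  /-- integer division, with value `0` if the divisor is `0` -/
  | div (r a b : ℕ) (s : State) :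
      Exec (.div r a b) s (lc r + s.opCost a + s.opCost b) (s.set r (s.mem a / s.mem b))
  /-- the content of the cell whose address is in the cell `a` is copied to the cell `r` -/
  | load (r a : ℕ) (s : State) :
      Exec (.load r a) s (lc r + lc a + s.opCost (s.mem a)) (s.set r (s.mem (s.mem a)))
  /-- the content of the cell `b` is copied to the cell whose address is in the cell `a` -/
  | store (a b : ℕ) (s : State) :
      Exec (.store a b) s (s.opCost a + s.opCost b) (s.set (s.mem a) (s.mem b))
  /-- the next number on the input tape is read; past the end of the input it is `0` -/
  | read (r : ℕ) (s : State) :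
      Exec (.read r) s (lc r + lc (s.input.headD 0))
        { s.set r (s.input.headD 0) with input := s.input.tail }
  | seq {p q : Prog} {s s' s'' : State} {t t' : ℕ} :
      Exec p s t s' → Exec q s' t' s'' → Exec (.seq p q) s (t + t') s''
  | ite_true {a : ℕ} {p q : Prog} {s s' : State} {t : ℕ} :
      s.mem a ≠ 0 → Exec p s t s' → Exec (.ite a p q) s (s.opCost a + t) s'
  | ite_false {a : ℕ} {p q : Prog} {s s' : State} {t : ℕ} :
      s.mem a = 0 → Exec q s t s' → Exec (.ite a p q) s (s.opCost a + t) s'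
  | while_true {a : ℕ} {p : Prog} {s s' s'' : State} {t t' : ℕ} :
      s.mem a ≠ 0 → Exec p s t s' → Exec (.while a p) s' t' s'' →
      Exec (.while a p) s (s.opCost a + t + t') s''
  | while_false {a : ℕ} {p : Prog} {s : State} :
      s.mem a = 0 → Exec (.while a p) s (s.opCost a) s

/-- Size of an input word: the total logarithmic cost of its entries. -/
def inputSize (w : List ℕ) : ℕ := (w.map lc).sum

/-- The run of a program from a given state is unique. -/
theorem Exec.unique {p : Prog} {s s₁ s₂ : State} {t₁ t₂ : ℕ}
    (h₁ : Exec p s t₁ s₁) (h₂ : Exec p s t₂ s₂) : t₁ = t₂ ∧ s₁ = s₂ := by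
  induction h₁ generalizing t₂ s₂ with
  | seq _ _ ih ih' =>
    cases h₂ with
    | seq h h' =>
      obtain ⟨rfl, rfl⟩ := ih h
      obtain ⟨rfl, rfl⟩ := ih' h'
      exact ⟨rfl, rfl⟩
  | ite_true ha _ ih =>
    cases h₂ with
    | ite_true _ h =>
      obtain ⟨rfl, rfl⟩ := ih h
      exact ⟨rfl, rfl⟩
    | ite_false hb _ => exact absurd hb ha
  | ite_false ha _ ih =>
    cases h₂ with
    | ite_true hb _ => exact absurd ha hb
    | ite_false _ h =>
      obtain ⟨rfl, rfl⟩ := ih h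
      exact ⟨rfl, rfl⟩
  | while_true ha _ _ ih ih' =>
    cases h₂ with
    | while_true _ h h' =>
      obtain ⟨rfl, rfl⟩ := ih h
      obtain ⟨rfl, rfl⟩ := ih' h'
      exact ⟨rfl, rfl⟩
    | while_false hb => exact absurd hb ha
  | while_false ha =>
    cases h₂ with
    | while_true hb _ _ => exact absurd ha hb
    | while_false _ => exact ⟨rfl, rfl⟩
  | _ => cases h₂; exact ⟨rfl, rfl⟩

/-- The decision problem with instances `{a // D a}`, encoding `enc` and question `yes` is
fixed-parameter tractable with respect to the parameter `k`: one program decides every instance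
`a` in time `f (k a) * p (|a|)` for a function `f` and a polynomial `p`. The answer is left in
cell `0`: `1` for yes and `0` for no. -/
def IsFPT {α : Type} (D : α → Prop) (enc : α → List ℕ) (k : α → ℕ) (yes : α → Prop) : Prop :=
  ∃ (P : Prog) (f : ℕ → ℕ) (p : Polynomial ℕ), ∀ a : α, D a →
    ∃ (t : ℕ) (s : State), Exec P (start (enc a)) t s ∧
      t ≤ f (k a) * p.eval (inputSize (enc a)) ∧
      (yes a → s.mem 0 = 1) ∧ (¬ yes a → s.mem 0 = 0)

end RAM

/-!
Contract the leaves of the tree one after the other into their neighbours. A remaining vertex `v`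
then stands for a connected set `B` of items that is attached to the other items only through `v`.
Hence all that matters about `B` is a table with `2 ^ n * (n + 1)` entries: for each set `S` of
players and each player `i`, the greatest weight for `i` of a connected bundle in `B` that contains
`v` and leaves disjoint connected bundles in `B` of sufficient weight for the players in `S`. The
index `i = n` stands for the case that `v` is allocated to nobody. When `c` is contracted into `p`,
either the bundle of `p` extends into the part of `c`, and the weights add up, or all bundles stay
within their parts; in both cases `S` splits between the two parts, so the new table is a maximum
over pairs of sets of players. The answer can be read off from the table of the last vertex.
Multiplied by `n` and a common denominator, the utilities become natural numbers.

For the running time, an instruction is charged a unit, plus the size of the second factor or of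
the number read where a number may grow by more than a bit. A run of charge `K` then creates only
numbers of size `O(K)`, so its logarithmic cost is `O(K ^ 2)`, and it suffices to bound charges,
which add up along the structure of a program.
-/

namespace RAM

/-! ### Charged runs -/

/-- The total size of the numbers written in a program. -/
def Prog.statics : Prog → ℕ
  | .skip => 0
  | .const r c => r.size + c.size
  | .copy r a => r.size + a.size
  | .add r a b => r.size + a.size + b.size
  | .sub r a b => r.size + a.size + b.size
  | .mul r a b => r.size + a.size + b.size
  | .div r a b => r.size + a.size + b.size
  | .load r a => r.size + a.size
  | .store a b => a.size + b.size
  | .read r => r.size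
  | .seq p q => p.statics + q.statics
  | .ite a p q => a.size + p.statics + q.statics
  | .while a p => a.size + p.statics

/-- The program `p` leads from `σ` to `σ'` with charge at most `K`. Every instruction is charged
one unit, a multiplication also the size of its second factor, and an input instruction also the
size of the number read. The charge bounds the growth of the numbers in memory, and thereby the
logarithmic cost of the run. -/
def Runs (p : Prog) (σ : State) (K : ℕ) (σ' : State) : Prop :=
  ∀ B, p.statics ≤ B → (∀ x, (σ.mem x).size ≤ B) →
    ∃ t, Exec p σ t σ' ∧ t ≤ 6 * K * (B + K + 1) ∧ ∀ x, (σ'.mem x).size ≤ B + K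

theorem size_add_le (a b : ℕ) : (a + b).size ≤ max a.size b.size + 1 := by
  rw [Nat.size_le, pow_succ, mul_two]
  exact add_lt_add (Nat.size_le.1 (le_max_left _ _)) (Nat.size_le.1 (le_max_right _ _))

theorem size_mul_le (a b : ℕ) : (a * b).size ≤ a.size + b.size := by
  rw [Nat.size_le, pow_add]
  exact Nat.mul_lt_mul'' (Nat.lt_size_self a) (Nat.lt_size_self b)

theorem size_le_self (a : ℕ) : a.size ≤ a := Nat.size_le.2 Nat.lt_two_pow_self

theorem size_mem_set_le {σ : State} {B K r x : ℕ} (h : ∀ y, (σ.mem y).size ≤ B)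
    (hx : x.size ≤ B + K) (y : ℕ) : ((σ.set r x).mem y).size ≤ B + K := by
  simp only [State.set, Function.update_apply]
  split
  · exact hx
  · exact (h y).trans (Nat.le_add_right _ _)

theorem Runs.mono {p : Prog} {σ σ' : State} {K K' : ℕ} (h : Runs p σ K σ') (hK : K ≤ K') :
    Runs p σ K' σ' := by
  intro B hB hσ
  obtain ⟨t, ht, hc, hs⟩ := h B hB hσ
  exact ⟨t, ht, hc.trans (by gcongr), fun x => (hs x).trans (by omega)⟩

theorem runs_const (r c : ℕ) (σ : State) : Runs (.const r c) σ 1 (σ.set r c) := by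
  intro B hB hσ
  simp only [Prog.statics] at hB
  refine ⟨_, .const r c σ, ?_, size_mem_set_le hσ (by omega)⟩
  simp only [lc]; omega

theorem runs_copy (r a : ℕ) (σ : State) : Runs (.copy r a) σ 1 (σ.set r (σ.mem a)) := by
  intro B hB hσ
  simp only [Prog.statics] at hB
  have := hσ a
  refine ⟨_, .copy r a σ, ?_, size_mem_set_le hσ (by omega)⟩
  simp only [lc, State.opCost]; omega

theorem runs_load (r a : ℕ) (σ : State) :
    Runs (.load r a) σ 1 (σ.set r (σ.mem (σ.mem a))) := by
  intro B hB hσ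
  simp only [Prog.statics] at hB
  have ha := hσ a
  have hb := hσ (σ.mem a)
  refine ⟨_, .load r a σ, ?_, size_mem_set_le hσ (by omega)⟩
  simp only [lc, State.opCost]; omega

theorem runs_store (a b : ℕ) (σ : State) :
    Runs (.store a b) σ 1 (σ.set (σ.mem a) (σ.mem b)) := by
  intro B hB hσ
  simp only [Prog.statics] at hB
  have ha := hσ a
  have hb := hσ b
  refine ⟨_, .store a b σ, ?_, size_mem_set_le hσ (by omega)⟩
  simp only [lc, State.opCost]; omega

theorem runs_read (r : ℕ) (σ : State) :
    Runs (.read r) σ (1 + (σ.input.headD 0).size)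
      { σ.set r (σ.input.headD 0) with input := σ.input.tail } := by
  intro B hB hσ
  simp only [Prog.statics] at hB
  refine ⟨_, .read r σ, ?_, size_mem_set_le hσ (by omega)⟩
  simp only [lc]
  nlinarith

theorem runs_of_exec_binary {p : Prog} {σ : State} {r a b x K : ℕ}
    (h : Exec p σ (lc r + σ.opCost a + σ.opCost b) (σ.set r x))
    (hp : r.size + a.size + b.size ≤ p.statics) (hK : 1 ≤ K)
    (hx : x.size ≤ max (σ.mem a).size (σ.mem b).size + K) : Runs p σ K (σ.set r x) := by
  intro B hB hσ
  have ha := hσ a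
  have hb := hσ b
  refine ⟨_, h, ?_, size_mem_set_le hσ (by omega)⟩
  simp only [lc, State.opCost]
  nlinarith

theorem runs_add (r a b : ℕ) (σ : State) :
    Runs (.add r a b) σ 1 (σ.set r (σ.mem a + σ.mem b)) :=
  runs_of_exec_binary (.add r a b σ) le_rfl le_rfl (size_add_le _ _)

theorem runs_sub (r a b : ℕ) (σ : State) :
    Runs (.sub r a b) σ 1 (σ.set r (σ.mem a - σ.mem b)) := by
  have := Nat.size_le_size (Nat.sub_le (σ.mem a) (σ.mem b))
  exact runs_of_exec_binary (.sub r a b σ) le_rfl le_rfl (by omega)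

theorem runs_div (r a b : ℕ) (σ : State) :
    Runs (.div r a b) σ 1 (σ.set r (σ.mem a / σ.mem b)) := by
  have := Nat.size_le_size (Nat.div_le_self (σ.mem a) (σ.mem b))
  exact runs_of_exec_binary (.div r a b σ) le_rfl le_rfl (by omega)

theorem runs_mul (r a b : ℕ) (σ : State) :
    Runs (.mul r a b) σ (1 + (σ.mem b).size) (σ.set r (σ.mem a * σ.mem b)) := by
  have := size_mul_le (σ.mem a) (σ.mem b)
  exact runs_of_exec_binary (.mul r a b σ) le_rfl (by omega) (by omega)

theorem Runs.seq {p q : Prog} {σ σ' σ'' : State} {K K' : ℕ} (h : Runs p σ K σ')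
    (h' : Runs q σ' K' σ'') : Runs (.seq p q) σ (K + K') σ'' := by
  intro B hB hσ
  simp only [Prog.statics] at hB
  obtain ⟨t, ht, hc, hs⟩ := h B (by omega) hσ
  obtain ⟨t', ht', hc', hs'⟩ := h' (B + K) (by omega) hs
  refine ⟨_, .seq ht ht', ?_, fun x => (hs' x).trans (by omega)⟩
  nlinarith

theorem Runs.ite_true {a : ℕ} {p : Prog} (q : Prog) {σ σ' : State} {K : ℕ} (ha : σ.mem a ≠ 0)
    (h : Runs p σ K σ') : Runs (.ite a p q) σ (1 + K) σ' := by
  intro B hB hσ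
  simp only [Prog.statics] at hB
  obtain ⟨t, ht, hc, hs⟩ := h B (by omega) hσ
  have := hσ a
  refine ⟨_, .ite_true ha ht, ?_, fun x => (hs x).trans (by omega)⟩
  simp only [lc, State.opCost]
  nlinarith

theorem Runs.ite_false {a : ℕ} (p : Prog) {q : Prog} {σ σ' : State} {K : ℕ} (ha : σ.mem a = 0)
    (h : Runs q σ K σ') : Runs (.ite a p q) σ (1 + K) σ' := by
  intro B hB hσ
  simp only [Prog.statics] at hB
  obtain ⟨t, ht, hc, hs⟩ := h B (by omega) hσ
  have := hσ a
  refine ⟨_, .ite_false ha ht, ?_, fun x => (hs x).trans (by omega)⟩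
  simp only [lc, State.opCost]
  nlinarith

theorem runs_while_false {a : ℕ} (p : Prog) {σ : State} (ha : σ.mem a = 0) :
    Runs (.while a p) σ 1 σ := by
  intro B hB hσ
  simp only [Prog.statics] at hB
  have := hσ a
  refine ⟨_, .while_false ha, ?_, fun x => (hσ x).trans (by omega)⟩
  simp only [lc, State.opCost]
  omega

theorem Runs.while_true {a : ℕ} {p : Prog} {σ σ' σ'' : State} {K K' : ℕ} (ha : σ.mem a ≠ 0)
    (h : Runs p σ K σ') (h' : Runs (.while a p) σ' K' σ'') :
    Runs (.while a p) σ (1 + K + K') σ'' := by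
  intro B hB hσ
  have hp : a.size + p.statics ≤ B := hB
  obtain ⟨t, ht, hc, hs⟩ := h B (by omega) hσ
  obtain ⟨t', ht', hc', hs'⟩ := h' (B + K) (by omega) hs
  have := hσ a
  refine ⟨_, .while_true ha ht ht', ?_, fun x => (hs' x).trans (by omega)⟩
  simp only [lc, State.opCost]
  nlinarith

theorem exists_runs_while {a n K : ℕ} {p : Prog} {Inv : ℕ → State → Prop}
    (hcount : ∀ j σ, Inv j σ → σ.mem a = n - j)
    (hbody : ∀ j < n, ∀ σ, Inv j σ → ∃ σ', Runs p σ K σ' ∧ Inv (j + 1) σ')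
    {j : ℕ} (hj : j ≤ n) {σ : State} (hσ : Inv j σ) :
    ∃ σ', Runs (.while a p) σ ((n - j) * (K + 1) + 1) σ' ∧ Inv n σ' := by
  induction k : n - j generalizing j σ with
  | zero =>
    obtain rfl : j = n := by omega
    exact ⟨σ, (runs_while_false p ((hcount j σ hσ).trans k)).mono (by omega), hσ⟩
  | succ k ih =>
    obtain ⟨σ', hrun, hσ'⟩ := hbody j (by omega) σ hσ
    obtain ⟨σ'', hrest, hσ''⟩ := ih (by omega) hσ' (by omega)
    have ha : σ.mem a ≠ 0 := by rw [hcount j σ hσ]; omega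
    exact ⟨σ'', (hrun.while_true ha hrest).mono (by rw [add_mul]; omega), hσ''⟩

end RAM

namespace RAM

/-! ### Variables, registers and arrays -/

/-- The address of entry `j` of array `k` when `w` infinite arrays are interleaved in the memory. -/
def cell {w : ℕ} (k : Fin w) (j : ℕ) : ℕ := j * w + k

/-- The memory content in which `w` infinite arrays are interleaved. -/
def interleave {w : ℕ} [NeZero w] (g : Fin w → ℕ → ℕ) (x : ℕ) : ℕ := g (Fin.ofNat w x) (x / w)

section Interleave

variable {w : ℕ}

theorem cell_inj {k k' : Fin w} {j j' : ℕ} : cell k j = cell k' j' ↔ k = k' ∧ j = j' := by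
  refine ⟨fun h => ?_, by rintro ⟨rfl, rfl⟩; rfl⟩
  have hk := congrArg (· % w) h
  simp only [cell, Nat.mul_add_mod_self_right, Nat.mod_eq_of_lt k.is_lt,
    Nat.mod_eq_of_lt k'.is_lt] at hk
  simp only [cell, hk, add_left_inj] at h
  exact ⟨Fin.ext hk, Nat.eq_of_mul_eq_mul_right k.pos h⟩

variable [NeZero w] (g : Fin w → ℕ → ℕ)

theorem interleave_cell (k : Fin w) (j : ℕ) : interleave g (cell k j) = g k j := by
  have hmod : Fin.ofNat w (cell k j) = k := by
    simp [Fin.ext_iff, cell, Nat.mul_add_mod_self_right, Nat.mod_eq_of_lt k.is_lt]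
  have hdiv : cell k j / w = j := by
    rw [cell, mul_comm, Nat.mul_add_div (NeZero.pos w), Nat.div_eq_of_lt k.is_lt, add_zero]
  rw [interleave, hmod, hdiv]

theorem update_interleave (k : Fin w) (j y : ℕ) :
    Function.update (interleave g) (cell k j) y =
      interleave (Function.update g k (Function.update (g k) j y)) := by
  funext x
  obtain ⟨k', j', rfl⟩ : ∃ (k' : Fin w) (j' : ℕ), x = cell k' j' :=
    ⟨Fin.ofNat w x, x / w, (Nat.div_add_mod' x w).symm⟩
  simp only [interleave_cell, Function.update_apply, cell_inj]
  rcases eq_or_ne k' k with rfl | hk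
  · simp [Function.update_apply]
  · simp [hk]

end Interleave

/-- The address of a variable. -/
abbrev varCell (x : ℕ) : ℕ := cell (0 : Fin 6) x

/-- The address of an auxiliary register. -/
abbrev auxCell (t : ℕ) : ℕ := cell (1 : Fin 6) t

/-- The address of an array entry. -/
abbrev arrCell (k : Fin 4) (j : ℕ) : ℕ := cell (k.succ.succ : Fin 6) j

/-- What a routine computes with: variables, four arrays, and the unread part of the input. -/
structure Env where
  var : ℕ → ℕ
  arr : Fin 4 → ℕ → ℕ
  input : List ℕ

namespace Env

/-- Assignment of `y` to the variable `x`. -/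
def setVar (s : Env) (x y : ℕ) : Env := { s with var := Function.update s.var x y }

/-- Replacement of the array `k` by `g`. -/
def setArr (s : Env) (k : Fin 4) (g : ℕ → ℕ) : Env := { s with arr := Function.update s.arr k g }

/-- The environment after the next input number has been read into the variable `x`. -/
def pop (s : Env) (x : ℕ) : Env := { s.setVar x (s.input.headD 0) with input := s.input.tail }

/-- The machine state that holds the variables in the cells `varCell x`, auxiliary registers `τ`,
which no routine reads before it has written them, in the cells `auxCell t`, and the arrays in the
remaining cells. -/
def ram (s : Env) (τ : ℕ → ℕ) : State where
  mem := interleave (Fin.cons s.var (Fin.cons τ s.arr) : Fin 6 → ℕ → ℕ)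
  input := s.input

variable (s : Env) (τ : ℕ → ℕ)

@[simp] theorem var_setVar (x y : ℕ) : (s.setVar x y).var = Function.update s.var x y := rfl
@[simp] theorem arr_setVar (x y : ℕ) : (s.setVar x y).arr = s.arr := rfl
@[simp] theorem input_setVar (x y : ℕ) : (s.setVar x y).input = s.input := rfl
@[simp] theorem var_setArr (k : Fin 4) (g : ℕ → ℕ) : (s.setArr k g).var = s.var := rfl
@[simp] theorem arr_setArr (k : Fin 4) (g : ℕ → ℕ) :
    (s.setArr k g).arr = Function.update s.arr k g := rfl
@[simp] theorem input_setArr (k : Fin 4) (g : ℕ → ℕ) : (s.setArr k g).input = s.input := rfl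
@[simp] theorem var_pop (x : ℕ) :
    (s.pop x).var = Function.update s.var x (s.input.headD 0) := rfl
@[simp] theorem arr_pop (x : ℕ) : (s.pop x).arr = s.arr := rfl
@[simp] theorem input_pop (x : ℕ) : (s.pop x).input = s.input.tail := rfl

@[simp] theorem setVar_setVar (x y z : ℕ) : (s.setVar x y).setVar x z = s.setVar x z := by
  simp [setVar]

@[simp] theorem setVar_self (x : ℕ) : s.setVar x (s.var x) = s := by simp [setVar]

@[simp] theorem setArr_setArr (k : Fin 4) (g h : ℕ → ℕ) :
    (s.setArr k g).setArr k h = s.setArr k h := by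
  simp [setArr]

@[simp] theorem setArr_self (k : Fin 4) : s.setArr k (s.arr k) = s := by simp [setArr]

theorem setArr_setVar (x y : ℕ) (k : Fin 4) (g : ℕ → ℕ) :
    (s.setVar x y).setArr k g = (s.setArr k g).setVar x y := rfl

@[simp] theorem ram_mem_var (x : ℕ) : (s.ram τ).mem (varCell x) = s.var x :=
  interleave_cell (w := 6) (Fin.cons s.var (Fin.cons τ s.arr)) 0 x

@[simp] theorem ram_mem_aux (t : ℕ) : (s.ram τ).mem (auxCell t) = τ t :=
  interleave_cell (w := 6) (Fin.cons s.var (Fin.cons τ s.arr)) 1 t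

@[simp] theorem ram_mem_arr (k : Fin 4) (j : ℕ) :
    (s.ram τ).mem (arrCell k j) = s.arr k j :=
  interleave_cell (w := 6) (Fin.cons s.var (Fin.cons τ s.arr)) k.succ.succ j

@[simp] theorem ram_set_var (x y : ℕ) :
    (s.ram τ).set (varCell x) y = (s.setVar x y).ram τ := by
  simp only [ram, State.set, update_interleave, Fin.cons_zero, Fin.update_cons_zero, setVar]

@[simp] theorem ram_set_aux (t y : ℕ) :
    (s.ram τ).set (auxCell t) y = s.ram (Function.update τ t y) := by
  have h : (1 : Fin 6) = Fin.succ 0 := rfl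
  simp only [ram, State.set, update_interleave, h, Fin.cons_succ, Fin.cons_zero,
    ← Fin.cons_update, Fin.update_cons_zero]

@[simp] theorem ram_set_arr (k : Fin 4) (j y : ℕ) :
    (s.ram τ).set (arrCell k j) y =
      (s.setArr k (Function.update (s.arr k) j y)).ram τ := by
  simp only [ram, State.set, update_interleave, Fin.cons_succ, ← Fin.cons_update, setArr]

end Env

end RAM

namespace RAM

/-! ### Routines -/

theorem runs_copy_aux_var (s : Env) (τ : ℕ → ℕ) (d x : ℕ) :
    Runs (.copy (auxCell d) (varCell x)) (s.ram τ) 1 (s.ram (Function.update τ d (s.var x))) := by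
  simpa using runs_copy (auxCell d) (varCell x) (s.ram τ)

theorem runs_copy_var_aux (s : Env) (τ : ℕ → ℕ) (x d : ℕ) :
    Runs (.copy (varCell x) (auxCell d)) (s.ram τ) 1 ((s.setVar x (τ d)).ram τ) := by
  simpa using runs_copy (varCell x) (auxCell d) (s.ram τ)

theorem runs_copy_aux (s : Env) (τ : ℕ → ℕ) (d e : ℕ) :
    Runs (.copy (auxCell d) (auxCell e)) (s.ram τ) 1 (s.ram (Function.update τ d (τ e))) := by
  simpa using runs_copy (auxCell d) (auxCell e) (s.ram τ)

theorem runs_const_aux (s : Env) (τ : ℕ → ℕ) (d c : ℕ) :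
    Runs (.const (auxCell d) c) (s.ram τ) 1 (s.ram (Function.update τ d c)) := by
  simpa using runs_const (auxCell d) c (s.ram τ)

theorem runs_add_aux (s : Env) (τ : ℕ → ℕ) (d e f : ℕ) :
    Runs (.add (auxCell d) (auxCell e) (auxCell f)) (s.ram τ) 1
      (s.ram (Function.update τ d (τ e + τ f))) := by
  simpa using runs_add (auxCell d) (auxCell e) (auxCell f) (s.ram τ)

theorem runs_sub_aux (s : Env) (τ : ℕ → ℕ) (d e f : ℕ) :
    Runs (.sub (auxCell d) (auxCell e) (auxCell f)) (s.ram τ) 1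
      (s.ram (Function.update τ d (τ e - τ f))) := by
  simpa using runs_sub (auxCell d) (auxCell e) (auxCell f) (s.ram τ)

theorem runs_div_aux (s : Env) (τ : ℕ → ℕ) (d e f : ℕ) :
    Runs (.div (auxCell d) (auxCell e) (auxCell f)) (s.ram τ) 1
      (s.ram (Function.update τ d (τ e / τ f))) := by
  simpa using runs_div (auxCell d) (auxCell e) (auxCell f) (s.ram τ)

theorem runs_mul_aux (s : Env) (τ : ℕ → ℕ) (d e f : ℕ) :
    Runs (.mul (auxCell d) (auxCell e) (auxCell f)) (s.ram τ) (1 + (τ f).size)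
      (s.ram (Function.update τ d (τ e * τ f))) := by
  simpa using runs_mul (auxCell d) (auxCell e) (auxCell f) (s.ram τ)

/-- The binary operations that routines may use. -/
inductive BinOp : Type
  | add | sub | mul | div | max

namespace BinOp

/-- The operation that `code` carries out; `sub` is truncated subtraction. -/
def eval : BinOp → ℕ → ℕ → ℕ
  | add, x, y => x + y
  | sub, x, y => x - y
  | mul, x, y => x * y
  | div, x, y => x / y
  | max, x, y => Max.max x y

/-- Code that combines the auxiliary registers `d` and `e`, leaves the result in `d`, and may
overwrite `e`. -/
def code : BinOp → ℕ → ℕ → Prog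
  | add, d, e => .add (auxCell d) (auxCell d) (auxCell e)
  | sub, d, e => .sub (auxCell d) (auxCell d) (auxCell e)
  | mul, d, e => .mul (auxCell d) (auxCell d) (auxCell e)
  | div, d, e => .div (auxCell d) (auxCell d) (auxCell e)
  | max, d, e => .seq (.sub (auxCell e) (auxCell e) (auxCell d))
      (.add (auxCell d) (auxCell d) (auxCell e))

theorem exists_runs_code (o : BinOp) {M d e : ℕ} (hde : d ≠ e) (s : Env) (τ : ℕ → ℕ)
    (hM : o = mul → (τ e).size ≤ M) :
    ∃ τ', Runs (o.code d e) (s.ram τ) (M + 2) (s.ram τ') ∧ τ' d = o.eval (τ d) (τ e) ∧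
      ∀ t, t ≠ d → t ≠ e → τ' t = τ t := by
  cases o with
  | add => exact ⟨_, (runs_add_aux s τ d d e).mono (by omega), by simp [eval], by simp_all⟩
  | sub => exact ⟨_, (runs_sub_aux s τ d d e).mono (by omega), by simp [eval], by simp_all⟩
  | div => exact ⟨_, (runs_div_aux s τ d d e).mono (by omega), by simp [eval], by simp_all⟩
  | mul =>
    have := hM rfl
    exact ⟨_, (runs_mul_aux s τ d d e).mono (by omega), by simp [eval], by simp_all⟩
  | max =>
    refine ⟨_, ((runs_sub_aux s τ e e d).seq (runs_add_aux s _ d d e)).mono (by omega), ?_, ?_⟩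
    · simp only [Function.update_self, Function.update_of_ne hde, eval]
      omega
    · simp_all

end BinOp

/-- Code for a computation that can be used at any place of a larger program: `code d` overwrites
only auxiliary registers from `d` on. The charge of a run is the value of the polynomial `charge`
at a common bound for the loop counts and the sizes of the numbers read or multiplied with. A
routine serves as an expression if it leaves its value in the auxiliary register `d`, and
as a statement if it changes the environment. -/
structure Routine where
  code : ℕ → Prog
  charge : Polynomial ℕ

namespace Routine

/-- As an expression, `e` has the value `x` in the environment `s`. -/
def Computes (M : ℕ) (e : Routine) (s : Env) (x : ℕ) : Prop :=
  ∀ d τ, ∃ τ', Runs (e.code d) (s.ram τ) (e.charge.eval M) (s.ram τ') ∧ τ' d = x ∧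
    ∀ t < d, τ' t = τ t

/-- As a statement, `p` leads from the environment `s` to one with the property `Q`. -/
def Ensures (M : ℕ) (p : Routine) (s : Env) (Q : Env → Prop) : Prop :=
  ∀ d τ, ∃ s' τ', Runs (p.code d) (s.ram τ) (p.charge.eval M) (s'.ram τ') ∧ Q s' ∧
    ∀ t < d, τ' t = τ t

variable {M : ℕ} {s : Env} {Q : Env → Prop} {p q c e f : Routine} {x y : ℕ}

theorem Ensures.imp {Q' : Env → Prop} (h : p.Ensures M s Q) (hQ : ∀ t, Q t → Q' t) :
    p.Ensures M s Q' := by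
  intro d τ
  obtain ⟨s', τ', hrun, hs', hτ'⟩ := h d τ
  exact ⟨s', τ', hrun, hQ s' hs', hτ'⟩

noncomputable section

/-- The expression for the value of a variable. -/
def var (x : ℕ) : Routine := ⟨fun d => .copy (auxCell d) (varCell x), 1⟩

theorem computes_var (x : ℕ) : (var x).Computes M s (s.var x) := by
  intro d τ
  refine ⟨_, (runs_copy_aux_var s τ d x).mono (by simp [var]), Function.update_self .., ?_⟩
  exact fun t ht => Function.update_of_ne ht.ne _ _

/-- The expression for a constant. -/
def lit (c : ℕ) : Routine := ⟨fun d => .const (auxCell d) c, 1⟩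

theorem computes_lit (c : ℕ) : (lit c).Computes M s c := by
  intro d τ
  refine ⟨_, (runs_const_aux s τ d c).mono (by simp [lit]), Function.update_self .., ?_⟩
  exact fun t ht => Function.update_of_ne ht.ne _ _

/-- The expression that combines the values of `e` and `f` by the operation `o`. -/
def op (o : BinOp) (e f : Routine) : Routine where
  code d := .seq (e.code d) (.seq (f.code (d + 1)) (o.code d (d + 1)))
  charge := e.charge + f.charge + (.X + 2)

theorem Computes.op (o : BinOp) (he : e.Computes M s x) (hf : f.Computes M s y)
    (hM : o = .mul → y.size ≤ M) : (Routine.op o e f).Computes M s (o.eval x y) := by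
  intro d τ
  obtain ⟨τ₁, hrun₁, hx, hlow₁⟩ := he d τ
  obtain ⟨τ₂, hrun₂, hy, hlow₂⟩ := hf (d + 1) τ₁
  obtain ⟨τ₃, hrun₃, hval, hlow₃⟩ := o.exists_runs_code (M := M) (d := d) (e := d + 1)
    (by omega) s τ₂ (by rwa [hy])
  refine ⟨τ₃, (hrun₁.seq (hrun₂.seq hrun₃)).mono ?_, ?_, fun t ht => ?_⟩
  · simp [Routine.op, add_assoc]
  · rw [hval, hy, hlow₂ d (by omega), hx]
  · rw [hlow₃ t (by omega) (by omega), hlow₂ t (by omega), hlow₁ t ht]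

instance : Add Routine := ⟨op .add⟩
instance : Sub Routine := ⟨op .sub⟩
instance : Mul Routine := ⟨op .mul⟩
instance : Div Routine := ⟨op .div⟩

theorem Computes.add (he : e.Computes M s x) (hf : f.Computes M s y) :
    (e + f).Computes M s (x + y) := he.op .add hf (by simp)

theorem Computes.sub (he : e.Computes M s x) (hf : f.Computes M s y) :
    (e - f).Computes M s (x - y) := he.op .sub hf (by simp)

theorem Computes.mul (he : e.Computes M s x) (hf : f.Computes M s y) (hy : y.size ≤ M) :
    (e * f).Computes M s (x * y) := he.op .mul hf fun _ => hy

theorem Computes.div (he : e.Computes M s x) (hf : f.Computes M s y) :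
    (e / f).Computes M s (x / y) := he.op .div hf (by simp)

/-- Code that turns the index in the auxiliary register `d` into an address in the array `k`, by
means of the auxiliary register `e`. -/
def addressCode (k : Fin 4) (d e : ℕ) : Prog :=
  .seq (.const (auxCell e) 6) <| .seq (.mul (auxCell d) (auxCell d) (auxCell e)) <|
  .seq (.const (auxCell e) (k + 2)) <| .add (auxCell d) (auxCell d) (auxCell e)

theorem exists_runs_addressCode (s : Env) (τ : ℕ → ℕ) {d e : ℕ} (hde : d ≠ e) (k : Fin 4) :
    ∃ τ', Runs (addressCode k d e) (s.ram τ) 7 (s.ram τ') ∧ τ' d = arrCell k (τ d) ∧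
      ∀ t, t ≠ d → t ≠ e → τ' t = τ t := by
  refine ⟨_, ((runs_const_aux s τ e 6).seq ((runs_mul_aux s _ d d e).seq
    ((runs_const_aux s _ e (k + 2)).seq (runs_add_aux s _ d d e)))).mono ?_, ?_, ?_⟩
  · have : Nat.size 6 = 3 := by decide
    simp [this]
  · simp [hde, cell, add_assoc]
  · simp_all

/-- The entry of the array `k` whose index is the value of `e`. -/
def arr (k : Fin 4) (e : Routine) : Routine where
  code d := .seq (e.code d) (.seq (addressCode k d (d + 1)) (.load (auxCell d) (auxCell d)))
  charge := e.charge + 8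

theorem Computes.arr (k : Fin 4) (he : e.Computes M s x) :
    (Routine.arr k e).Computes M s (s.arr k x) := by
  intro d τ
  obtain ⟨τ₁, hrun₁, hx, hlow₁⟩ := he d τ
  obtain ⟨τ₂, hrun₂, haddr, hlow₂⟩ := exists_runs_addressCode s τ₁ (by omega : d ≠ d + 1) k
  have hrun₃ := runs_load (auxCell d) (auxCell d) (s.ram τ₂)
  rw [Env.ram_mem_aux, haddr, Env.ram_mem_arr, Env.ram_set_aux, hx] at hrun₃
  refine ⟨_, (hrun₁.seq (hrun₂.seq hrun₃)).mono (by simp [Routine.arr]),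
    Function.update_self .., fun t ht => ?_⟩
  rw [Function.update_of_ne ht.ne, hlow₂ t (by omega) (by omega), hlow₁ t ht]

/-- The value of `e` or of `f`, according as the value of `c` is nonzero or zero. -/
def ite (c e f : Routine) : Routine where
  code d := .seq (c.code d) (.ite (auxCell d) (e.code d) (f.code d))
  charge := c.charge + e.charge + f.charge + 1

theorem Computes.ite_ne_zero (hc : c.Computes M s y) (hy : y ≠ 0) (he : e.Computes M s x) :
    (Routine.ite c e f).Computes M s x := by
  intro d τ
  obtain ⟨τ₁, hrun₁, hval, hlow₁⟩ := hc d τ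
  obtain ⟨τ₂, hrun₂, hx, hlow₂⟩ := he d τ₁
  refine ⟨τ₂, (hrun₁.seq (hrun₂.ite_true _ ?_)).mono ?_, hx, fun t ht => ?_⟩
  · rwa [Env.ram_mem_aux, hval]
  · simp only [Routine.ite, Polynomial.eval_add, Polynomial.eval_one]
    omega
  · rw [hlow₂ t ht, hlow₁ t ht]

theorem Computes.ite_zero (hc : c.Computes M s 0) (hf : f.Computes M s x) :
    (Routine.ite c e f).Computes M s x := by
  intro d τ
  obtain ⟨τ₁, hrun₁, hval, hlow₁⟩ := hc d τ
  obtain ⟨τ₂, hrun₂, hx, hlow₂⟩ := hf d τ₁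
  refine ⟨τ₂, (hrun₁.seq (hrun₂.ite_false _ ?_)).mono ?_, hx, fun t ht => ?_⟩
  · rwa [Env.ram_mem_aux]
  · simp only [Routine.ite, Polynomial.eval_add, Polynomial.eval_one]
    omega
  · rw [hlow₂ t ht, hlow₁ t ht]

theorem Computes.ite {z : ℕ} (hc : c.Computes M s y) (he : y ≠ 0 → e.Computes M s x)
    (hf : y = 0 → f.Computes M s z) :
    (Routine.ite c e f).Computes M s (if y ≠ 0 then x else z) := by
  split_ifs with hy
  · exact hc.ite_ne_zero hy (he hy)
  · rw [not_not] at hy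
    exact (hy ▸ hc).ite_zero (hf hy)

/-- Round of a loop with body `p` whose variable `i` runs through the numbers below the content of
the auxiliary register `d`; the register `d + 1` holds the number of rounds that remain. -/
def roundCode (i d : ℕ) (p : Prog) : Prog :=
  .seq (.sub (varCell i) (auxCell d) (auxCell (d + 1))) <| .seq p <|
  .seq (.const (auxCell (d + 3)) 1) <| .sub (auxCell (d + 1)) (auxCell (d + 1)) (auxCell (d + 3))

/-- Loop with body `p` whose variable `i` runs through the numbers below the content of the
auxiliary register `d`; the value of `i` is saved in the register `d + 2` and finally restored. -/
def loopCode (i d : ℕ) (p : Prog) : Prog :=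
  .seq (.copy (auxCell (d + 1)) (auxCell d)) <| .seq (.copy (auxCell (d + 2)) (varCell i)) <|
  .seq (.while (auxCell (d + 1)) (roundCode i d p)) <| .copy (varCell i) (auxCell (d + 2))

/-- The machine states before round `j` of a loop with `n` rounds and invariant `Inv`. -/
def LoopState (Inv : ℕ → Env → (ℕ → ℕ) → Prop) (d n saved j : ℕ) (σ : State) : Prop :=
  ∃ s τ, σ = s.ram τ ∧ Inv j s τ ∧ τ d = n ∧ τ (d + 1) = n - j ∧ τ (d + 2) = saved

section Loop

variable {i d n K : ℕ} {b : Prog} {Inv : ℕ → Env → (ℕ → ℕ) → Prop}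
  (hlow : ∀ j s τ τ', Inv j s τ → (∀ t < d, τ' t = τ t) → Inv j s τ')
  (hbody : ∀ j < n, ∀ s τ, Inv j s τ → ∃ s' τ', Runs b ((s.setVar i j).ram τ) K (s'.ram τ') ∧
    Inv (j + 1) s' τ' ∧ ∀ t, d ≤ t → t < d + 3 → τ' t = τ t)

include hlow hbody

theorem LoopState.exists_runs_roundCode {saved j : ℕ} {σ : State} (hj : j < n)
    (hσ : LoopState Inv d n saved j σ) :
    ∃ σ', Runs (roundCode i d b) σ (K + 3) σ' ∧ LoopState Inv d n saved (j + 1) σ' := by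
  obtain ⟨s, τ, rfl, hinv, hn, hrest, hsaved⟩ := hσ
  obtain ⟨s', τ', hrun, hinv', hτ'⟩ := hbody j hj s τ hinv
  have hset := runs_sub (varCell i) (auxCell d) (auxCell (d + 1)) (s.ram τ)
  rw [Env.ram_mem_aux, Env.ram_mem_aux, hn, hrest, Nat.sub_sub_self hj.le,
    Env.ram_set_var] at hset
  refine ⟨_, (hset.seq (hrun.seq ((runs_const_aux s' τ' (d + 3) 1).seq
    (runs_sub_aux s' _ (d + 1) (d + 1) (d + 3))))).mono (by omega), s', _, rfl,
    hlow _ _ _ _ hinv' fun t ht => ?_, ?_, ?_, ?_⟩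
  · rw [Function.update_of_ne (by omega), Function.update_of_ne (by omega)]
  · simp [hτ', hn]
  · simp [hτ', hrest, Nat.sub_sub]
  · simp [hτ', hsaved]

theorem exists_runs_loopCode {s : Env} {τ : ℕ → ℕ} (hs : Inv 0 s τ) (hn : τ d = n) :
    ∃ s' τ', Runs (loopCode i d b) (s.ram τ) (n * (K + 4) + 4)
      ((s'.setVar i (s.var i)).ram τ') ∧ Inv n s' τ' := by
  have hcopy := runs_copy_aux s τ (d + 1) d
  have hsave := runs_copy_aux_var s (Function.update τ (d + 1) (τ d)) (d + 2) i
  set τ₀ := Function.update (Function.update τ (d + 1) (τ d)) (d + 2) (s.var i) with hτ₀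
  have hstart : LoopState Inv d n (s.var i) 0 (s.ram τ₀) := by
    refine ⟨s, τ₀, rfl, hlow _ _ _ _ hs fun t ht => ?_, by simp [hτ₀, hn], by simp [hτ₀, hn],
      by simp [hτ₀]⟩
    rw [hτ₀, Function.update_of_ne (by omega), Function.update_of_ne (by omega)]
  obtain ⟨_, hwhile, s', τ', rfl, hinv, -, -, hi⟩ :=
    exists_runs_while (Inv := LoopState Inv d n (s.var i)) (a := auxCell (d + 1))
      (by rintro j _ ⟨s', τ', rfl, -, -, hj, -⟩; rw [Env.ram_mem_aux, hj])
      (fun j hj σ => LoopState.exists_runs_roundCode hlow hbody hj) n.zero_le hstart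
  have hrestore := runs_copy_var_aux s' τ' i (d + 2)
  rw [hi] at hrestore
  refine ⟨s', τ', (hcopy.seq (hsave.seq (hwhile.seq hrestore))).mono (le_of_eq ?_), hinv⟩
  rw [Nat.sub_zero, add_assoc K]
  ring

end Loop

/-- The left fold of the values of `b` for `i = 0, …, n - 1`, with start value `z`, where `n` is the
value of `N`. -/
def fold (o : BinOp) (z i : ℕ) (N b : Routine) : Routine where
  code d := .seq (.const (auxCell d) z) <| .seq (N.code (d + 1)) <|
    loopCode i (d + 1) (.seq (b.code (d + 4)) (o.code d (d + 4)))
  charge := N.charge + .X * (b.charge + .X + 6) + 5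

theorem Computes.fold (o : BinOp) {i n : ℕ} {N b : Routine} {g f : ℕ → ℕ}
    (hN : N.Computes M s n) (hn : n ≤ M) (hb : ∀ j < n, b.Computes M (s.setVar i j) (f j))
    (hM : ∀ j < n, o = .mul → (f j).size ≤ M) (hg : ∀ j < n, g (j + 1) = o.eval (g j) (f j)) :
    (Routine.fold o (g 0) i N b).Computes M s (g n) := by
  intro d τ
  obtain ⟨τ₁, hrun₁, hn₁, hlow₁⟩ := hN (d + 1) (Function.update τ d (g 0))
  let Inv (j : ℕ) (s' : Env) (τ' : ℕ → ℕ) : Prop :=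
    (∃ x, s' = s.setVar i x) ∧ τ' d = g j ∧ ∀ t < d, τ' t = τ t
  have hkeep : ∀ j s' τ' τ'', Inv j s' τ' → (∀ t < d + 1, τ'' t = τ' t) → Inv j s' τ'' := by
    rintro j s' τ' τ'' ⟨hs', hd, hl⟩ h
    exact ⟨hs', (h d (by omega)).trans hd, fun t ht => (h t (by omega)).trans (hl t ht)⟩
  have hround : ∀ j < n, ∀ s' τ', Inv j s' τ' →
      ∃ s'' τ'', Runs (.seq (b.code (d + 4)) (o.code d (d + 4))) ((s'.setVar i j).ram τ')
        (b.charge.eval M + (M + 2)) (s''.ram τ'') ∧ Inv (j + 1) s'' τ'' ∧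
        ∀ t, d + 1 ≤ t → t < d + 1 + 3 → τ'' t = τ' t := by
    rintro j hj _ τ' ⟨⟨x, rfl⟩, hd, hl⟩
    rw [Env.setVar_setVar]
    obtain ⟨τ₂, hrun₂, hval₂, hlow₂⟩ := hb j hj (d + 4) τ'
    obtain ⟨τ₃, hrun₃, hval₃, hlow₃⟩ := o.exists_runs_code (M := M) (d := d) (e := d + 4)
      (by omega) (s.setVar i j) τ₂ (by rw [hval₂]; exact hM j hj)
    refine ⟨_, τ₃, hrun₂.seq hrun₃, ⟨⟨j, rfl⟩, ?_, fun t ht => ?_⟩, fun t ht ht' => ?_⟩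
    · rw [hval₃, hval₂, hlow₂ d (by omega), hd, hg j hj]
    · rw [hlow₃ t (by omega) (by omega), hlow₂ t (by omega), hl t ht]
    · rw [hlow₃ t (by omega) (by omega), hlow₂ t (by omega)]
  have hstart : Inv 0 s τ₁ := by
    refine ⟨⟨s.var i, by simp⟩, ?_, fun t ht => ?_⟩
    · rw [hlow₁ d (by omega), Function.update_self]
    · rw [hlow₁ t (by omega), Function.update_of_ne ht.ne]
  obtain ⟨_, τ₂, hrun₂, ⟨x, rfl⟩, hval, hlow₂⟩ := exists_runs_loopCode hkeep hround hstart hn₁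
  rw [Env.setVar_setVar, Env.setVar_self] at hrun₂
  refine ⟨τ₂, ((runs_const_aux s τ d (g 0)).seq (hrun₁.seq hrun₂)).mono ?_, hval, hlow₂⟩
  have := Nat.mul_le_mul hn (by omega :
    b.charge.eval M + (M + 2) + 4 ≤ b.charge.eval M + M + 6)
  simp only [Routine.fold, Polynomial.eval_add, Polynomial.eval_mul, Polynomial.eval_X,
    Polynomial.eval_ofNat]
  omega

/-- The statement that assigns the value of `e` to the variable `x`. -/
def assign (x : ℕ) (e : Routine) : Routine where
  code d := .seq (e.code d) (.copy (varCell x) (auxCell d))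
  charge := e.charge + 1

theorem Ensures.assign (he : e.Computes M s y) (hQ : Q (s.setVar x y)) :
    (Routine.assign x e).Ensures M s Q := by
  intro d τ
  obtain ⟨τ', hrun, hy, hlow⟩ := he d τ
  refine ⟨_, τ', (hrun.seq (runs_copy_var_aux s τ' x d)).mono ?_, by rwa [hy], hlow⟩
  simp [Routine.assign]

/-- The statement that stores the value of `f` in the array `k` at the index given by `e`. -/
def write (k : Fin 4) (e f : Routine) : Routine where
  code d := .seq (e.code d) <| .seq (f.code (d + 1)) <| .seq (addressCode k d (d + 2)) <|
    .store (auxCell d) (auxCell (d + 1))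
  charge := e.charge + f.charge + 8

theorem Ensures.write {k : Fin 4} (he : e.Computes M s x) (hf : f.Computes M s y)
    (hQ : Q (s.setArr k (Function.update (s.arr k) x y))) :
    (Routine.write k e f).Ensures M s Q := by
  intro d τ
  obtain ⟨τ₁, hrun₁, hx, hlow₁⟩ := he d τ
  obtain ⟨τ₂, hrun₂, hy, hlow₂⟩ := hf (d + 1) τ₁
  obtain ⟨τ₃, hrun₃, haddr, hlow₃⟩ := exists_runs_addressCode s τ₂ (by omega : d ≠ d + 2) k
  have hrun₄ := runs_store (auxCell d) (auxCell (d + 1)) (s.ram τ₃)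
  rw [Env.ram_mem_aux, Env.ram_mem_aux, haddr, Env.ram_set_arr,
    hlow₃ (d + 1) (by omega) (by omega), hy, hlow₂ d (by omega), hx] at hrun₄
  refine ⟨_, τ₃, (hrun₁.seq (hrun₂.seq (hrun₃.seq hrun₄))).mono ?_, hQ, fun t ht => ?_⟩
  · simp [Routine.write, add_assoc]
  · rw [hlow₃ t (by omega) (by omega), hlow₂ t (by omega), hlow₁ t ht]

/-- The statement that reads the next input number into the variable `x`. -/
def read (x : ℕ) : Routine := ⟨fun _ => .read (varCell x), 1 + .X⟩

theorem ensures_read (hM : (s.input.headD 0).size ≤ M) (hQ : Q (s.pop x)) :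
    (read x).Ensures M s Q := by
  intro d τ
  have hrun := runs_read (varCell x) (s.ram τ)
  rw [Env.ram_set_var] at hrun
  refine ⟨s.pop x, τ, hrun.mono ?_, hQ, fun _ _ => rfl⟩
  simp only [read, Polynomial.eval_add, Polynomial.eval_one, Polynomial.eval_X]
  exact Nat.add_le_add_left hM 1

/-- The statement `p` followed by the statement `q`. -/
def seq (p q : Routine) : Routine := ⟨fun d => .seq (p.code d) (q.code d), p.charge + q.charge⟩

theorem Ensures.seq {Q' : Env → Prop} (hp : p.Ensures M s Q')
    (hq : ∀ t, Q' t → q.Ensures M t Q) : (p.seq q).Ensures M s Q := by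
  intro d τ
  obtain ⟨s₁, τ₁, hrun₁, hs₁, hlow₁⟩ := hp d τ
  obtain ⟨s₂, τ₂, hrun₂, hs₂, hlow₂⟩ := hq s₁ hs₁ d τ₁
  exact ⟨s₂, τ₂, (hrun₁.seq hrun₂).mono (by simp [Routine.seq]), hs₂,
    fun t ht => (hlow₂ t ht).trans (hlow₁ t ht)⟩

theorem Ensures.assign_seq (he : e.Computes M s y) (hq : q.Ensures M (s.setVar x y) Q) :
    ((Routine.assign x e).seq q).Ensures M s Q :=
  (Ensures.assign (Q := (· = s.setVar x y)) he rfl).seq fun _ h => h ▸ hq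

theorem ensures_read_seq (hM : (s.input.headD 0).size ≤ M) (hq : q.Ensures M (s.pop x) Q) :
    ((read x).seq q).Ensures M s Q :=
  (ensures_read (Q := (· = s.pop x)) hM rfl).seq fun _ h => h ▸ hq

/-- The statement `b` for `i = 0, …, n - 1`, where `n` is the value of `N`; the value of `i` is
restored at the end. -/
def loop (i : ℕ) (N b : Routine) : Routine where
  code d := .seq (N.code d) (loopCode i d (b.code (d + 3)))
  charge := N.charge + .X * (b.charge + 4) + 4

theorem Ensures.loop {i n : ℕ} {N b : Routine} (Inv : ℕ → Env → Prop) (hN : N.Computes M s n)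
    (hn : n ≤ M) (h0 : Inv 0 s)
    (hstep : ∀ j < n, ∀ t, Inv j t → b.Ensures M (t.setVar i j) (Inv (j + 1)))
    (hQ : ∀ t, Inv n t → Q (t.setVar i (s.var i))) : (Routine.loop i N b).Ensures M s Q := by
  intro d τ
  obtain ⟨τ₁, hrun₁, hn₁, hlow₁⟩ := hN d τ
  let Inv' (j : ℕ) (s' : Env) (τ' : ℕ → ℕ) : Prop := Inv j s' ∧ ∀ t < d, τ' t = τ t
  have hkeep : ∀ j s' τ' τ'', Inv' j s' τ' → (∀ t < d, τ'' t = τ' t) → Inv' j s' τ'' :=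
    fun _ _ _ _ ⟨hs', hl⟩ h => ⟨hs', fun t ht => (h t ht).trans (hl t ht)⟩
  have hround : ∀ j < n, ∀ s' τ', Inv' j s' τ' →
      ∃ s'' τ'', Runs (b.code (d + 3)) ((s'.setVar i j).ram τ') (b.charge.eval M)
        (s''.ram τ'') ∧ Inv' (j + 1) s'' τ'' ∧ ∀ t, d ≤ t → t < d + 3 → τ'' t = τ' t := by
    rintro j hj s' τ' ⟨hs', hl⟩
    obtain ⟨s'', τ'', hrun, hs'', hl'⟩ := hstep j hj s' hs' (d + 3) τ'
    exact ⟨s'', τ'', hrun, ⟨hs'', fun t ht => (hl' t (by omega)).trans (hl t ht)⟩,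
      fun t _ ht => hl' t ht⟩
  obtain ⟨s', τ₂, hrun₂, hinv, hlow₂⟩ := exists_runs_loopCode hkeep hround ⟨h0, hlow₁⟩ hn₁
  refine ⟨_, τ₂, (hrun₁.seq hrun₂).mono ?_, hQ s' hinv, hlow₂⟩
  have := Nat.mul_le_mul_right (b.charge.eval M + 4) hn
  simp only [Routine.loop, Polynomial.eval_add, Polynomial.eval_mul, Polynomial.eval_X,
    Polynomial.eval_ofNat]
  omega

end

end Routine

/-- The environment in which a program is started on the input `w`. -/
def Env.initial (w : List ℕ) : Env := ⟨fun _ => 0, fun _ _ => 0, w⟩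

theorem Env.ram_initial (w : List ℕ) : (Env.initial w).ram (fun _ => 0) = start w := by
  simp only [Env.initial, Env.ram, start, State.mk.injEq, and_true]
  funext x
  exact (Fin.forall_fin_succ.2 ⟨rfl, Fin.forall_fin_succ.2 ⟨rfl, fun _ => rfl⟩⟩ :
    ∀ k : Fin 6, (Fin.cons (fun _ => 0) (Fin.cons (fun _ => 0) fun _ _ => 0) :
      Fin 6 → ℕ → ℕ) k (x / 6) = 0) _

theorem Routine.Ensures.exists_exec {M : ℕ} {p : Routine} {w : List ℕ} {Q : Env → Prop}
    (h : p.Ensures M (.initial w) Q) :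
    ∃ t σ s, Exec (p.code 0) (start w) t σ ∧
      t ≤ 6 * p.charge.eval M * ((p.code 0).statics + p.charge.eval M + 1) ∧
      Q s ∧ σ.mem 0 = s.var 0 := by
  obtain ⟨s, τ, hrun, hs, -⟩ := h 0 fun _ => 0
  rw [Env.ram_initial] at hrun
  obtain ⟨t, ht, hc, -⟩ := hrun _ le_rfl (by simp [start])
  exact ⟨t, _, s, ht, hc, hs, s.ram_mem_var τ 0⟩

open Polynomial in
theorem eval_mul_le (p : ℕ[X]) (x y : ℕ) :
    p.eval (x * y) ≤ (x + 1) ^ p.natDegree * p.eval y := by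
  rw [eval_eq_sum_range, eval_eq_sum_range, Finset.mul_sum]
  refine Finset.sum_le_sum fun i hi => ?_
  have hx : x ^ i ≤ (x + 1) ^ p.natDegree :=
    (Nat.pow_le_pow_left x.le_succ i).trans
      (Nat.pow_le_pow_right x.succ_pos (Finset.mem_range_succ_iff.1 hi))
  rw [mul_pow, mul_left_comm]
  exact Nat.mul_le_mul_right _ hx

open Classical Polynomial in
theorem Routine.isFPT (p : Routine) {α : Type} {D : α → Prop} {enc : α → List ℕ} {k : α → ℕ}
    {yes : α → Prop} (g : ℕ → ℕ) (q : ℕ[X])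
    (h : ∀ a, D a → p.Ensures (g (k a) * q.eval (inputSize (enc a))) (.initial (enc a))
      fun s => s.var 0 = if yes a then 1 else 0) : IsFPT D enc k yes := by
  let R : ℕ[X] := 6 * p.charge * (C (p.code 0).statics + p.charge + 1)
  refine ⟨p.code 0, fun n => (g n + 1) ^ R.natDegree, R.comp q, fun a ha => ?_⟩
  obtain ⟨t, σ, s, hexec, ht, hs, hσ⟩ := (h a ha).exists_exec
  refine ⟨t, σ, hexec, ?_, fun hyes => ?_, fun hno => ?_⟩
  · have htime : t ≤ R.eval (g (k a) * q.eval (inputSize (enc a))) := by simpa [R] using ht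
    simpa using htime.trans (eval_mul_le R _ _)
  · rw [hσ, hs, if_pos hyes]
  · rw [hσ, hs, if_neg hno]

end RAM

namespace RAM.Routine

open Finset

/-! ### Derived routines -/

variable {M i n x y : ℕ} {s : Env} {N b e f : Routine} {g : ℕ → ℕ}

noncomputable section

/-- The sum of the values of `b` for `i = 0, …, n - 1`, where `n` is the value of `N`. -/
def sum (i : ℕ) (N b : Routine) : Routine := fold .add 0 i N b

theorem Computes.sum (hN : N.Computes M s n) (hn : n ≤ M)
    (hb : ∀ j < n, b.Computes M (s.setVar i j) (g j)) :
    (Routine.sum i N b).Computes M s (∑ j ∈ range n, g j) := by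
  simpa [Routine.sum] using Computes.fold .add (g := fun k => ∑ j ∈ range k, g j) hN hn hb (by simp)
    fun j _ => sum_range_succ g j

/-- The product of the values of `b` for `i = 0, …, n - 1`, where `n` is the value of `N`. -/
def prod (i : ℕ) (N b : Routine) : Routine := fold .mul 1 i N b

theorem Computes.prod (hN : N.Computes M s n) (hn : n ≤ M)
    (hb : ∀ j < n, b.Computes M (s.setVar i j) (g j)) (hM : ∀ j < n, (g j).size ≤ M) :
    (Routine.prod i N b).Computes M s (∏ j ∈ range n, g j) := by
  simpa [Routine.prod] using Computes.fold .mul (g := fun k => ∏ j ∈ range k, g j) hN hn hb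
    (fun j hj _ => hM j hj) fun j _ => prod_range_succ g j

/-- The maximum of the values of `b` for `i = 0, …, n - 1`, where `n` is the value of `N`. -/
def sup (i : ℕ) (N b : Routine) : Routine := fold .max 0 i N b

theorem Computes.sup (hN : N.Computes M s n) (hn : n ≤ M)
    (hb : ∀ j < n, b.Computes M (s.setVar i j) (g j)) :
    (Routine.sup i N b).Computes M s ((range n).sup g) := by
  simpa [Routine.sup] using Computes.fold .max (g := fun k => (range k).sup g) hN hn hb (by simp)
    fun j _ => by rw [range_add_one, sup_insert, sup_comm]; rfl

/-- The value of `b` if `e` and `f` have the same value, otherwise the value of `c`. -/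
def ifEq (e f b c : Routine) : Routine := ite (e - f + (f - e)) c b

theorem Computes.ifEq {c : Routine} {z z' : ℕ} (he : e.Computes M s x) (hf : f.Computes M s y)
    (hb : x = y → b.Computes M s z) (hc : x ≠ y → c.Computes M s z') :
    (Routine.ifEq e f b c).Computes M s (if x = y then z else z') := by
  have hiff : x - y + (y - x) = 0 ↔ x = y := by omega
  have := ((he.sub hf).add (hf.sub he)).ite (fun h => hc (hiff.not.1 h)) fun h => hb (hiff.1 h)
  simpa only [Routine.ifEq, ne_eq, ite_not, hiff] using this

/-- The power of two with exponent `N`, by means of the variable `i`. -/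
def twoPow (i : ℕ) (N : Routine) : Routine := prod i N (lit 2)

theorem Computes.twoPow (hN : N.Computes M s n) (hn : n ≤ M) (hM : 2 ≤ M) :
    (Routine.twoPow i N).Computes M s (2 ^ n) := by
  have h2 : Nat.size 2 = 2 := by decide
  simpa [Routine.twoPow] using Computes.prod (i := i) hN hn (fun _ _ => computes_lit 2)
    fun _ _ => h2.trans_le hM

/-- The remainder of the division of `e` by `f`. -/
def mod (e f : Routine) : Routine := e - e / f * f

theorem Computes.mod (he : e.Computes M s x) (hf : f.Computes M s y) (hy : y.size ≤ M) :
    (Routine.mod e f).Computes M s (x % y) := by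
  rw [Nat.mod_eq_sub_div_mul]
  exact he.sub ((he.div hf).mul hf hy)

/-- The binary digit of `e` at position `f`, by means of the variable `i`. -/
def testBit (i : ℕ) (e f : Routine) : Routine := mod (e / twoPow i f) (lit 2)

theorem Computes.testBit (he : e.Computes M s x) (hf : f.Computes M s y) (hy : y ≤ M)
    (hM : 2 ≤ M) : (Routine.testBit i e f).Computes M s (x.testBit y).toNat := by
  have h2 : Nat.size 2 = 2 := by decide
  rw [Nat.toNat_testBit]
  exact (he.div (hf.twoPow hy hM)).mod (computes_lit 2) (h2.trans_le hM)

/-- The entries of the array `k` at `i = 0, …, n - 1` are set to the values of `b`, where `n` is the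
value of `N`. -/
def tabulate (k : Fin 4) (i : ℕ) (N b : Routine) : Routine := loop i N (write k (var i) b)

theorem Ensures.tabulate {k : Fin 4} {Q : Env → Prop} (hN : N.Computes M s n) (hn : n ≤ M)
    (hb : ∀ j < n, ∀ a, b.Computes M ((s.setArr k a).setVar i j) (g j))
    (hQ : ∀ a, (∀ j < n, a j = g j) → Q (s.setArr k a)) :
    (Routine.tabulate k i N b).Ensures M s Q := by
  refine Ensures.loop
    (fun r t => ∃ a x, t = (s.setArr k a).setVar i x ∧ ∀ j < r, a j = g j) hN hn ?_ ?_ ?_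
  · exact ⟨s.arr k, s.var i, by simp, by simp⟩
  · rintro j hj _ ⟨a, x, rfl, ha⟩
    rw [Env.setVar_setVar]
    refine Ensures.write (computes_var i) (hb j hj a) ⟨Function.update a j (g j), j, ?_, ?_⟩
    · simp [Env.setArr_setVar]
    · intro l hl
      rcases (Nat.lt_succ_iff_lt_or_eq.1 hl) with hlj | rfl
      · rw [Function.update_of_ne hlj.ne, ha l hlj]
      · exact Function.update_self ..
  · rintro _ ⟨a, x, rfl, ha⟩
    have := hQ a ha
    rwa [Env.setVar_setVar, ← Env.var_setArr s k a, Env.setVar_self]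

end

end RAM.Routine

namespace ConnectedDivision

open Finset

/-! ### Serving players with disjoint connected bundles -/

section Induce

variable {V : Type*} {G : SimpleGraph V} {X B : Set V}

theorem exists_adj_of_preconnected_induce (hX : (G.induce X).Preconnected) {x y : V}
    (hx : x ∈ X) (hxB : x ∈ B) (hy : y ∈ X) (hyB : y ∉ B) :
    ∃ u ∈ X ∩ B, ∃ w ∈ X \ B, G.Adj u w := by
  obtain ⟨walk⟩ := hX ⟨x, hx⟩ ⟨y, hy⟩
  obtain ⟨d, -, hfst, hsnd⟩ := walk.exists_boundary_dart {z | (z : V) ∈ B} hxB hyB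
  exact ⟨d.fst, ⟨d.fst.2, hfst⟩, d.snd, ⟨d.snd.2, hsnd⟩, d.adj⟩

/-- Contracting `X \ B` to `p` maps a walk in `X` to one in `X ∩ B`. -/
theorem preconnected_induce_inter (hX : (G.induce X).Preconnected) {p : V} (hp : p ∈ X ∩ B)
    (h : ∀ x ∈ X ∩ B, ∀ y ∈ X \ B, G.Adj x y → x = p) : (G.induce (X ∩ B)).Preconnected := by
  classical
  let f : X → (X ∩ B : Set V) := fun x => if hx : (x : V) ∈ B then ⟨x, x.2, hx⟩ else ⟨p, hp⟩
  have hf : ∀ x y, (G.induce X).Adj x y → (G.induce (X ∩ B)).Reachable (f x) (f y) := by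
    rintro ⟨x, hx⟩ ⟨y, hy⟩ hxy
    replace hxy : G.Adj x y := hxy
    by_cases hxB : x ∈ B <;> by_cases hyB : y ∈ B <;> simp only [f, hxB, hyB, ↓reduceDIte]
    · exact SimpleGraph.Adj.reachable hxy
    · obtain rfl := h x ⟨hx, hxB⟩ y ⟨hy, hyB⟩ hxy
      rfl
    · obtain rfl := h y ⟨hy, hyB⟩ x ⟨hx, hxB⟩ hxy.symm
      rfl
    · rfl
  simp only [SimpleGraph.reachable_iff_reflTransGen] at hf
  rintro ⟨x, hx⟩ ⟨y, hy⟩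
  have hxy := hX ⟨x, hx.1⟩ ⟨y, hy.1⟩
  rw [SimpleGraph.reachable_iff_reflTransGen] at hxy ⊢
  simpa only [Function.onFun, f, hx.2, hy.2, ↓reduceDIte] using
    Relation.ReflTransGen.lift' f hf _ _ hxy

end Induce

variable {V ι R : Type*}

/-- Connected finite sets of items, including the empty set: the bundles that may be allocated. -/
abbrev IsBundle (G : SimpleGraph V) (X : Finset V) : Prop := (G.induce (X : Set V)).Preconnected

theorem isBundle_singleton (G : SimpleGraph V) (v : V) : IsBundle G {v} := by
  rw [IsBundle, coe_singleton]
  exact SimpleGraph.Preconnected.of_subsingleton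

section Serves

variable [AddCommMonoid R] [PartialOrder R] (G : SimpleGraph V) (W : ι → V → R) (D : R)

/-- The players in `A` can be given disjoint bundles inside `C`, each of weight at least `D` for the
player who gets it. -/
def Serves (C : Finset V) (A : Finset ι) : Prop :=
  ∃ π : ι → Finset V, (∀ j ∈ A, π j ⊆ C ∧ IsBundle G (π j) ∧ D ≤ ∑ v ∈ π j, W j v) ∧
    (A : Set ι).PairwiseDisjoint π

variable [DecidableEq V]

/-- There is a bundle inside `B` that contains `v` and has weight at least `k` for `i`, and the
players in `A` can be served by the rest of `B`. These are the partial solutions of the dynamic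
programme: `v` is the only vertex of `B` through which the bundle of `i` may still grow. -/
def Extends (B : Finset V) (v : V) (A : Finset ι) (i : ι) (k : R) : Prop :=
  ∃ X ⊆ B, v ∈ X ∧ IsBundle G X ∧ k ≤ ∑ x ∈ X, W i x ∧ Serves G W D (B \ X) A

end Serves

section

variable [AddCommMonoid R] [PartialOrder R] {G : SimpleGraph V} {W : ι → V → R} {D : R}
  {B C : Finset V} {A A₁ A₂ : Finset ι}

theorem Serves.mono (h : Serves G W D B A₁) (hBC : B ⊆ C) (hA : A ⊆ A₁) : Serves G W D C A := by
  obtain ⟨π, hπ, hdisj⟩ := h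
  exact ⟨π, fun j hj => ⟨(hπ j (hA hj)).1.trans hBC, (hπ j (hA hj)).2⟩,
    hdisj.subset (coe_subset.2 hA)⟩

theorem serves_empty (C : Finset V) : Serves G W D C ∅ := ⟨fun _ => ∅, by simp, by simp⟩

theorem serves_singleton {i : ι} (hB : IsBundle G B) (h : D ≤ ∑ x ∈ B, W i x) :
    Serves G W D B {i} := ⟨fun _ => B, by simp [hB, h], by simp⟩

theorem Serves.union [DecidableEq V] [DecidableEq ι] (h₁ : Serves G W D B A₁)
    (h₂ : Serves G W D C A₂) (hBC : Disjoint B C) : Serves G W D (B ∪ C) (A₁ ∪ A₂) := by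
  obtain ⟨π, hπ, hπdisj⟩ := h₁
  obtain ⟨ρ, hρ, hρdisj⟩ := h₂
  have hcross : ∀ j ∈ A₁, ∀ l ∈ A₂, Disjoint (π j) (ρ l) := fun j hj l hl =>
    hBC.mono (hπ j hj).1 (hρ l hl).1
  refine ⟨fun j => if j ∈ A₁ then π j else ρ j, fun j hj => ?_, fun j hj l hl hjl => ?_⟩
  · beta_reduce
    split_ifs with hj₁
    · exact ⟨(hπ j hj₁).1.trans subset_union_left, (hπ j hj₁).2⟩
    · have hj₂ := (mem_union.1 hj).resolve_left hj₁
      exact ⟨(hρ j hj₂).1.trans subset_union_right, (hρ j hj₂).2⟩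
  · rw [mem_coe, mem_union] at hj hl
    rw [Function.onFun]
    split_ifs with hj₁ hl₁ hl₁
    · exact hπdisj hj₁ hl₁ hjl
    · exact hcross j hj₁ l (hl.resolve_left hl₁)
    · exact (hcross l hl₁ j (hj.resolve_left hj₁)).symm
    · exact hρdisj (hj.resolve_left hj₁) (hl.resolve_left hl₁) hjl

variable [DecidableEq V] {v : V} {i : ι} {k : R}

theorem Extends.mono (h : Extends G W D B v A₁ i k) (hA : A ⊆ A₁) : Extends G W D B v A i k := by
  obtain ⟨X, hXB, hv, hX, hk, hs⟩ := h
  exact ⟨X, hXB, hv, hX, hk, hs.mono Subset.rfl hA⟩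

theorem Extends.serves [DecidableEq ι] (h : Extends G W D B v A₁ i D) (hA : A ⊆ insert i A₁) :
    Serves G W D B A := by
  obtain ⟨X, hXB, -, hX, hk, hs⟩ := h
  have := hs.union (serves_singleton hX hk) sdiff_disjoint
  rw [sdiff_union_of_subset hXB, union_comm, ← insert_eq] at this
  exact this.mono Subset.rfl hA

/-- The player `o` stands for the case that nobody gets `v`. -/
theorem Serves.exists_extends [DecidableEq ι] (h : Serves G W D B A) (hv : v ∈ B) {o : ι}
    (ho : D ≤ W o v) : ∃ i ∈ insert o A, Extends G W D B v (A.erase i) i D := by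
  obtain ⟨π, hπ, hdisj⟩ := h
  by_cases hex : ∃ i ∈ A, v ∈ π i
  · obtain ⟨i, hi, hvi⟩ := hex
    refine ⟨i, mem_insert_of_mem hi, π i, (hπ i hi).1, hvi, (hπ i hi).2.1, (hπ i hi).2.2, π,
      fun j hj => ?_, hdisj.subset (coe_subset.2 (erase_subset _ _))⟩
    obtain ⟨hji, hj⟩ := mem_erase.1 hj
    exact ⟨subset_sdiff.2 ⟨(hπ j hj).1, hdisj hj hi hji⟩, (hπ j hj).2⟩
  · push Not at hex
    refine ⟨o, mem_insert_self o A, Extends.mono (A₁ := A) ?_ (erase_subset o A)⟩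
    refine ⟨{v}, singleton_subset_iff.2 hv, mem_singleton_self v, isBundle_singleton G v, by simpa,
      π, fun j hj => ⟨subset_sdiff.2 ⟨(hπ j hj).1, ?_⟩, (hπ j hj).2⟩, hdisj⟩
    exact disjoint_singleton_right.2 (hex j hj)

theorem extends_singleton_iff (hD : ¬ D ≤ 0) :
    Extends G W D {v} v A i k ↔ A = ∅ ∧ k ≤ W i v := by
  constructor
  · rintro ⟨X, hX, hv, -, hk, π, hπ, -⟩
    obtain rfl : X = {v} := hX.antisymm (singleton_subset_iff.2 hv)
    refine ⟨eq_empty_iff_forall_notMem.2 fun j hj => hD ?_, by simpa using hk⟩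
    obtain ⟨hsub, -, hweight⟩ := hπ j hj
    obtain hempty : π j = ∅ := by simpa using hsub
    rwa [hempty, sum_empty] at hweight
  · rintro ⟨rfl, hk⟩
    exact ⟨{v}, Subset.rfl, mem_singleton_self v, isBundle_singleton G v, by simpa,
      serves_empty _⟩

section Bridge

variable {p c : V}

theorem IsBundle.subset_or_subset {X : Finset V} (hX : IsBundle G X) (hXBC : X ⊆ B ∪ C)
    (hp : p ∉ X) (hedge : ∀ x ∈ B, ∀ y ∈ C, G.Adj x y → x = p) : X ⊆ B ∨ X ⊆ C := by
  by_contra! hcon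
  obtain ⟨x, hx, hxB⟩ := not_subset.1 hcon.1
  obtain ⟨y, hy, hyC⟩ := not_subset.1 hcon.2
  have hyB := (mem_union.1 (hXBC hy)).resolve_right hyC
  obtain ⟨u, ⟨hu, huB⟩, w, ⟨hw, hwB⟩, huw⟩ :=
    exists_adj_of_preconnected_induce (B := (B : Set V)) hX hy hyB hx hxB
  have hwC := (mem_union.1 (hXBC hw)).resolve_left hwB
  exact hp (hedge u huB w hwC huw ▸ hu)

theorem IsBundle.inter_left {X : Finset V} (hX : IsBundle G X) (hXBC : X ⊆ B ∪ C)
    (hp : p ∈ X ∩ B) (hedge : ∀ x ∈ B, ∀ y ∈ C, G.Adj x y → x = p) : IsBundle G (X ∩ B) := by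
  rw [IsBundle, coe_inter]
  refine preconnected_induce_inter hX (by simpa using hp) fun x hx y hy hxy => ?_
  exact hedge x hx.2 y ((mem_union.1 (hXBC hy.1)).resolve_left hy.2) hxy

theorem Serves.exists_union [DecidableEq ι] {X : Finset V}
    (h : Serves G W D ((B ∪ C) \ X) A) (hp : p ∈ X)
    (hedge : ∀ x ∈ B, ∀ y ∈ C, G.Adj x y → x = p) :
    ∃ A₁ A₂, A₁ ∪ A₂ = A ∧ Serves G W D (B \ X) A₁ ∧ Serves G W D (C \ X) A₂ := by
  obtain ⟨π, hπ, hdisj⟩ := h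
  have hside : ∀ j ∈ A, π j ⊆ B ∨ π j ⊆ C := fun j hj =>
    (hπ j hj).2.1.subset_or_subset ((hπ j hj).1.trans sdiff_subset)
      (fun hpj => (mem_sdiff.1 ((hπ j hj).1 hpj)).2 hp) hedge
  have hX : ∀ j ∈ A, Disjoint (π j) X := fun j hj => (subset_sdiff.1 (hπ j hj).1).2
  refine ⟨A.filter fun j => π j ⊆ B, A.filter fun j => ¬ π j ⊆ B, filter_union_filter_not_eq _ A,
    ⟨π, fun j hj => ?_, hdisj.subset (coe_subset.2 (filter_subset _ _))⟩,
    ⟨π, fun j hj => ?_, hdisj.subset (coe_subset.2 (filter_subset _ _))⟩⟩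
  · obtain ⟨hj, hjB⟩ := mem_filter.1 hj
    exact ⟨subset_sdiff.2 ⟨hjB, hX j hj⟩, (hπ j hj).2⟩
  · obtain ⟨hj, hjB⟩ := mem_filter.1 hj
    exact ⟨subset_sdiff.2 ⟨(hside j hj).resolve_left hjB, hX j hj⟩, (hπ j hj).2⟩

variable (hBC : Disjoint B C)

include hBC

theorem Extends.exists_union [DecidableEq ι] (h : Extends G W D (B ∪ C) p A i k) (hp : p ∈ B)
    (hedge : ∀ x ∈ B, ∀ y ∈ C, G.Adj x y → x = p ∧ y = c) :
    ∃ A₁ A₂, A₁ ∪ A₂ = A ∧ ∃ k₁ k₂, k ≤ k₁ + k₂ ∧ Extends G W D B p A₁ i k₁ ∧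
      (Extends G W D C c A₂ i k₂ ∨ k₂ = 0 ∧ Serves G W D C A₂) := by
  obtain ⟨X, hXBC, hpX, hX, hk, hs⟩ := h
  have hedgeB : ∀ x ∈ B, ∀ y ∈ C, G.Adj x y → x = p := fun x hx y hy hxy =>
    (hedge x hx y hy hxy).1
  have hedgeC : ∀ y ∈ C, ∀ x ∈ B, G.Adj y x → y = c := fun y hy x hx hyx =>
    (hedge x hx y hy hyx.symm).2
  obtain ⟨A₁, A₂, hA, hs₁, hs₂⟩ := hs.exists_union hpX hedgeB
  have hpXB := mem_inter.2 ⟨hpX, hp⟩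
  have hsum : ∑ x ∈ X, W i x = ∑ x ∈ X ∩ B, W i x + ∑ x ∈ X ∩ C, W i x := by
    rw [← sum_union (hBC.mono inter_subset_right inter_subset_right), ← inter_union_distrib_left,
      inter_eq_left.2 hXBC]
  refine ⟨A₁, A₂, hA, _, _, hk.trans_eq hsum, ⟨X ∩ B, inter_subset_right, hpXB,
    hX.inter_left hXBC hpXB hedgeB, le_rfl, by rwa [sdiff_inter_self_right]⟩, ?_⟩
  by_cases hc : c ∈ X ∩ C
  · exact Or.inl ⟨X ∩ C, inter_subset_right, hc,
      hX.inter_left (union_comm B C ▸ hXBC) hc hedgeC, le_rfl,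
      by rwa [sdiff_inter_self_right]⟩
  · suffices hempty : X ∩ C = ∅ from
      Or.inr ⟨by rw [hempty, sum_empty], hs₂.mono sdiff_subset Subset.rfl⟩
    refine eq_empty_iff_forall_notMem.2 fun y hy => ?_
    obtain ⟨hyX, hyC⟩ := mem_inter.1 hy
    obtain ⟨w, ⟨hw, hwC⟩, u, ⟨hu, huC⟩, hwu⟩ :=
      exists_adj_of_preconnected_induce (B := (C : Set V)) hX hyX hyC hpX
        (disjoint_left.1 hBC hp)
    have huB := (mem_union.1 (hXBC hu)).resolve_right huC
    exact hc (mem_inter.2 (hedgeC w hwC u huB hwu ▸ ⟨hw, hwC⟩))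

theorem Extends.union_serves [DecidableEq ι] (h₁ : Extends G W D B p A₁ i k)
    (h₂ : Serves G W D C A₂) (hA : A ⊆ A₁ ∪ A₂) : Extends G W D (B ∪ C) p A i k := by
  obtain ⟨X, hXB, hpX, hX, hk, hs⟩ := h₁
  refine ⟨X, hXB.trans subset_union_left, hpX, hX, hk, ?_⟩
  rw [union_sdiff_distrib, sdiff_eq_self_of_disjoint (hBC.symm.mono_right hXB)]
  exact (hs.union h₂ (hBC.mono_left sdiff_subset)).mono Subset.rfl hA

theorem Extends.union [IsOrderedAddMonoid R] [DecidableEq ι] {k₁ k₂ : R}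
    (h₁ : Extends G W D B p A₁ i k₁) (h₂ : Extends G W D C c A₂ i k₂) (hpc : G.Adj p c)
    (hA : A ⊆ A₁ ∪ A₂) (hk : k ≤ k₁ + k₂) : Extends G W D (B ∪ C) p A i k := by
  obtain ⟨X, hXB, hpX, hX, hk₁, hs₁⟩ := h₁
  obtain ⟨Y, hYC, hcY, hY, hk₂, hs₂⟩ := h₂
  refine ⟨X ∪ Y, union_subset_union hXB hYC, mem_union_left Y hpX, ?_, ?_, ?_⟩
  · rw [IsBundle, coe_union]
    exact (SimpleGraph.connected_induce_union hX hY hpX hcY hpc).preconnected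
  · rw [sum_union (hBC.mono hXB hYC)]
    exact hk.trans (add_le_add hk₁ hk₂)
  · refine (hs₁.union hs₂ (hBC.mono sdiff_subset sdiff_subset)).mono (union_subset ?_ ?_) hA
    · exact subset_sdiff.2 ⟨sdiff_subset.trans subset_union_left,
        disjoint_union_right.2 ⟨sdiff_disjoint, hBC.mono sdiff_subset hYC⟩⟩
    · exact subset_sdiff.2 ⟨sdiff_subset.trans subset_union_right,
        disjoint_union_right.2 ⟨(hBC.mono hXB sdiff_subset).symm, sdiff_disjoint⟩⟩

end Bridge

end

/-! ### Contracting leaves -/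

variable {G : SimpleGraph V}

/-- The map `r` contracts the graph onto the vertices in `A`, and a vertex in `A` is the only one
of its fiber with neighbours outside of the fiber. -/
structure IsContraction (G : SimpleGraph V) (A : Finset V) (r : V → V) : Prop where
  mem : ∀ x, r x ∈ A
  apply_eq : ∀ v ∈ A, r v = v
  adj : ∀ x y, G.Adj x y → r x ≠ r y → r x = x

theorem isContraction_id [Fintype V] (G : SimpleGraph V) : IsContraction G univ id :=
  ⟨mem_univ, fun _ _ => rfl, fun _ _ _ _ => rfl⟩

theorem IsContraction.update [DecidableEq V] {A : Finset V} {r : V → V}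
    (h : IsContraction G A r) {p c : V} (hp : p ∈ A) (hpc : p ≠ c)
    (hleaf : ∀ w ∈ A, G.Adj c w → w = p) :
    IsContraction G (A.erase c) (Function.update id c p ∘ r) where
  mem x := by
    by_cases hx : r x = c
    · simp [hx, hpc, hp]
    · simp [hx, h.mem x]
  apply_eq v hv := by
    obtain ⟨hvc, hv⟩ := mem_erase.1 hv
    simp [h.apply_eq v hv, hvc]
  adj x y hxy hne := by
    have hrxy : r x ≠ r y := fun heq => hne (congrArg (Function.update id c p) heq)
    have hx := h.adj x y hxy hrxy
    have hy := h.adj y x hxy.symm hrxy.symm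
    rcases eq_or_ne x c with rfl | hxc
    · have hyp : y = p := hleaf y (hy ▸ h.mem y) hxy
      rw [Function.comp_apply, Function.comp_apply, hx, hy, hyp, Function.update_self,
        Function.update_of_ne hpc, id] at hne
      exact absurd rfl hne
    · simp [hx, hxc]

section

variable {A : Finset V} (hA : (G.induce (A : Set V)).Preconnected)

include hA

theorem exists_leaf_of_isAcyclic (hG : G.IsAcyclic) (hcard : 1 < #A) :
    ∃ c ∈ A, ∃! w, w ∈ A ∧ G.Adj c w := by
  classical
  obtain ⟨x, hx, y, hy, hxy⟩ := one_lt_card.1 hcard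
  have : Nontrivial (A : Set V) := ⟨⟨x, hx⟩, ⟨y, hy⟩, by simpa using hxy⟩
  have htree : (G.induce (A : Set V)).IsTree :=
    ⟨(SimpleGraph.connected_iff _).2 ⟨hA, ⟨x, hx⟩⟩, hG.induce _⟩
  obtain ⟨c, hc⟩ := htree.exists_vert_degree_one_of_nontrivial
  obtain ⟨w, hcw, hunique⟩ := SimpleGraph.degree_eq_one_iff_existsUnique_adj.1 hc
  refine ⟨c, c.2, w, ⟨w.2, hcw⟩, ?_⟩
  rintro z ⟨hz, hcz⟩
  exact congrArg Subtype.val (hunique ⟨z, hz⟩ hcz)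

theorem preconnected_induce_erase [DecidableEq V] {p c : V} (hp : p ∈ A) (hpc : p ≠ c)
    (hleaf : ∀ w ∈ A, G.Adj c w → w = p) : (G.induce (A.erase c : Set V)).Preconnected := by
  rw [coe_erase, Set.sdiff_eq]
  refine preconnected_induce_inter hA ⟨hp, hpc⟩ fun x hx y hy hxy => ?_
  obtain rfl : y = c := by simpa [hy.1] using hy.2
  exact hleaf x hx.1 hxy.symm

end

end ConnectedDivision

namespace ConnectedDivision

open Finset

/-! ### Tables of partial solutions -/

/-- The players below `n` that the binary digits of `S` encode. -/
def players (n S : ℕ) : Finset ℕ := {j ∈ range n | S.testBit j}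

/-- The number of players encoded by `S` but neither by `S₁` nor by `S₂`. -/
def uncovered (n S S₁ S₂ : ℕ) : ℕ :=
  ∑ j ∈ range n, ((S.testBit j).toNat - ((S₁.testBit j).toNat + (S₂.testBit j).toNat))

variable {n S S₁ S₂ : ℕ}

theorem mem_players {j : ℕ} : j ∈ players n S ↔ j < n ∧ S.testBit j := by
  simp [players]

theorem players_subset_range (n S : ℕ) : players n S ⊆ range n := filter_subset _ _

theorem exists_players_eq {A : Finset ℕ} (hA : A ⊆ range n) : ∃ S < 2 ^ n, players n S = A := by
  refine ⟨Nat.ofBits fun j : Fin n => decide ((j : ℕ) ∈ A), Nat.ofBits_lt_two_pow _, ?_⟩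
  ext j
  rw [mem_players]
  refine ⟨fun ⟨hj, h⟩ => by simpa [Nat.testBit_ofBits_lt _ j hj] using h, fun h => ?_⟩
  have hj := mem_range.1 (hA h)
  exact ⟨hj, by simpa [Nat.testBit_ofBits_lt _ j hj] using h⟩

theorem players_eq_empty_iff (hS : S < 2 ^ n) : players n S = ∅ ↔ S = 0 := by
  refine ⟨fun h => Nat.eq_of_testBit_eq fun j => ?_, by rintro rfl; simp [players]⟩
  rw [Nat.zero_testBit, ← Bool.not_eq_true]
  intro hj
  have hjn : j < n := (Nat.pow_lt_pow_iff_right one_lt_two).1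
    ((Nat.ge_two_pow_of_testBit hj).trans_lt hS)
  exact notMem_empty j (h ▸ mem_players.2 ⟨hjn, hj⟩)

theorem players_two_pow_sub_one (n : ℕ) : players n (2 ^ n - 1) = range n := by
  ext j
  simp [mem_players, Nat.testBit_two_pow_sub_one]

theorem uncovered_eq_zero_iff :
    uncovered n S S₁ S₂ = 0 ↔ players n S ⊆ players n S₁ ∪ players n S₂ := by
  rw [uncovered, sum_eq_zero_iff]
  refine forall_congr' fun j => ?_
  rw [mem_union, mem_players, mem_players, mem_players, mem_range]
  cases S.testBit j <;> cases S₁.testBit j <;> cases S₂.testBit j <;> simp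

theorem uncovered_two_pow_eq_zero_iff {i : ℕ} :
    uncovered n S S₁ (2 ^ i) = 0 ↔ players n S ⊆ insert i (players n S₁) := by
  rw [uncovered_eq_zero_iff]
  refine forall_congr' fun j => forall_congr' fun hj => ?_
  have hjn := (mem_players.1 hj).1
  simp only [mem_union, mem_insert, mem_players, Nat.testBit_two_pow, hjn, true_and,
    decide_eq_true_eq]
  rw [or_comm, eq_comm]

/-- Whether all players encoded by `S` can be served, according to the table `t`. -/
def served (D n : ℕ) (t : ℕ → ℕ → ℕ) (S : ℕ) : ℕ :=
  (range (n + 1)).sup fun i => (range (2 ^ n)).sup fun S₁ =>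
    if uncovered n S S₁ (2 ^ i) ≠ 0 then 0 else if t S₁ i - D ≠ 0 then 1 else 0

/-- The sum of two weights, where a weight is stored as its successor and `0` stands for `-∞`. -/
def joined (a b : ℕ) : ℕ := if a ≠ 0 then if b ≠ 0 then a + b - 1 else 0 else 0

/-- The table of a vertex with table `t` after the contraction of a neighbour with table `t'`. -/
def mergeTable (D n : ℕ) (t t' : ℕ → ℕ → ℕ) (S i : ℕ) : ℕ :=
  (range (2 ^ n)).sup fun S₁ => (range (2 ^ n)).sup fun S₂ =>
    if uncovered n S S₁ S₂ ≠ 0 then 0 else joined (t S₁ i) (max (t' S₂ i) (served D n t' S₂))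

theorem lt_sup_range_iff {N k : ℕ} {f : ℕ → ℕ} : k < (range N).sup f ↔ ∃ j < N, k < f j := by
  simp [Finset.lt_sup_iff]

theorem lt_joined_iff {a b k : ℕ} :
    k < joined a b ↔ ∃ k₁ k₂, k ≤ k₁ + k₂ ∧ k₁ < a ∧ k₂ < b := by
  rw [joined]
  constructor
  · split_ifs
    · exact fun h => ⟨a - 1, b - 1, by omega, by omega, by omega⟩
    all_goals simp
  · rintro ⟨k₁, k₂, hk, ha, hb⟩
    rw [if_pos (Nat.ne_zero_of_lt ha), if_pos (Nat.ne_zero_of_lt hb)]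
    omega

variable {V : Type*} [DecidableEq V] {G : SimpleGraph V} {W : ℕ → V → ℕ} {D : ℕ}

/-- The table `t` of the vertex `v` of the part `B`: the entry `t S i` is the successor of the
greatest weight for `i` of a bundle with `v` in `B` that leaves enough for the players encoded by
`S`, or `0` if there is none. The index `i = n` stands for nobody. -/
def IsTable (G : SimpleGraph V) (W : ℕ → V → ℕ) (D n : ℕ) (B : Finset V) (v : V)
    (t : ℕ → ℕ → ℕ) : Prop :=
  ∀ S < 2 ^ n, ∀ i < n + 1, ∀ k, k < t S i ↔ Extends G W D B v (players n S) i k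

theorem isTable_singleton (hD : 0 < D) (v : V) :
    IsTable G W D n {v} v fun S i => if S ≠ 0 then 0 else W i v + 1 := by
  intro S hS i _ k
  rw [extends_singleton_iff hD.not_ge, players_eq_empty_iff hS]
  by_cases h : S = 0 <;> simp [h]

section

variable {B C : Finset V} {v p c : V} {t t' : ℕ → ℕ → ℕ}

theorem IsTable.congr (ht : IsTable G W D n B v t)
    (h : ∀ S < 2 ^ n, ∀ i < n + 1, t' S i = t S i) : IsTable G W D n B v t' :=
  fun S hS i hi k => by rw [h S hS i hi, ht S hS i hi k]

variable (hW : ∀ v, D ≤ W n v)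

include hW

theorem IsTable.lt_served_iff (ht : IsTable G W D n B v t) (hv : v ∈ B) (S k : ℕ) :
    k < served D n t S ↔ k = 0 ∧ Serves G W D B (players n S) := by
  simp only [served, lt_sup_range_iff]
  constructor
  · rintro ⟨i, hi, S₁, hS₁, h⟩
    split_ifs at h with hcov hD
    · exact absurd h k.not_lt_zero
    · rw [not_not, uncovered_two_pow_eq_zero_iff] at hcov
      have hext := (ht S₁ hS₁ i hi D).1 (Nat.sub_ne_zero_iff_lt.1 hD)
      exact ⟨Nat.lt_one_iff.1 h, hext.serves hcov⟩
    · exact absurd h k.not_lt_zero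
  · rintro ⟨rfl, h⟩
    obtain ⟨i, hi, hext⟩ := h.exists_extends hv (hW v)
    have hin : i < n + 1 := by
      rcases mem_insert.1 hi with rfl | hi
      · exact i.lt_succ_self
      · exact (mem_players.1 hi).1.trans n.lt_succ_self
    obtain ⟨S₁, hS₁, hcode⟩ :=
      exists_players_eq ((erase_subset i _).trans (players_subset_range n S))
    have hcov : uncovered n S S₁ (2 ^ i) = 0 := by
      rw [uncovered_two_pow_eq_zero_iff, hcode]
      exact subset_insert_iff.2 Subset.rfl
    have hD : t S₁ i - D ≠ 0 :=
      Nat.sub_ne_zero_iff_lt.2 ((ht S₁ hS₁ i hin D).2 (hcode ▸ hext))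
    exact ⟨i, hin, S₁, hS₁, by rw [if_neg (not_not.2 hcov), if_pos hD]; exact one_pos⟩

theorem IsTable.merge (ht : IsTable G W D n B p t) (ht' : IsTable G W D n C c t')
    (hBC : Disjoint B C) (hp : p ∈ B) (hc : c ∈ C) (hpc : G.Adj p c)
    (hedge : ∀ x ∈ B, ∀ y ∈ C, G.Adj x y → x = p ∧ y = c) :
    IsTable G W D n (B ∪ C) p (mergeTable D n t t') := by
  intro S _ i hi k
  simp only [mergeTable, lt_sup_range_iff]
  constructor
  · rintro ⟨S₁, hS₁, S₂, hS₂, h⟩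
    split_ifs at h with hcov
    · exact absurd h k.not_lt_zero
    · rw [not_not, uncovered_eq_zero_iff] at hcov
      obtain ⟨k₁, k₂, hk, hk₁, hk₂⟩ := lt_joined_iff.1 h
      have h₁ := (ht S₁ hS₁ i hi k₁).1 hk₁
      rcases lt_max_iff.1 hk₂ with hk₂ | hk₂
      · exact h₁.union hBC ((ht' S₂ hS₂ i hi k₂).1 hk₂) hpc hcov hk
      · obtain ⟨rfl, h₂⟩ := (ht'.lt_served_iff hW hc S₂ k₂).1 hk₂
        exact ((ht S₁ hS₁ i hi k).1 (hk.trans_lt hk₁)).union_serves hBC h₂ hcov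
  · intro h
    obtain ⟨A₁, A₂, hA, k₁, k₂, hk, h₁, h₂⟩ := h.exists_union hBC hp hedge
    have hrange : A₁ ∪ A₂ ⊆ range n := hA ▸ players_subset_range n S
    obtain ⟨S₁, hS₁, rfl⟩ := exists_players_eq (subset_union_left.trans hrange)
    obtain ⟨S₂, hS₂, rfl⟩ := exists_players_eq (subset_union_right.trans hrange)
    refine ⟨S₁, hS₁, S₂, hS₂, ?_⟩
    rw [if_neg (not_not.2 (uncovered_eq_zero_iff.2 hA.ge))]
    refine lt_joined_iff.2 ⟨k₁, k₂, hk, (ht S₁ hS₁ i hi k₁).2 h₁, lt_max_iff.2 ?_⟩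
    exact h₂.imp (ht' S₂ hS₂ i hi k₂).2 (ht'.lt_served_iff hW hc S₂ k₂).2

end

section

variable [Fintype V] {A : Finset V} {t t' : V → ℕ → ℕ → ℕ}

/-- The function `t` gives tables of the remaining vertices `A` of a contraction of the graph, and
these vertices still induce a connected graph. -/
def IsTableFamily (G : SimpleGraph V) (W : ℕ → V → ℕ) (D n : ℕ) (A : Finset V)
    (t : V → ℕ → ℕ → ℕ) : Prop :=
  (G.induce (A : Set V)).Preconnected ∧
    ∃ r, IsContraction G A r ∧ ∀ v ∈ A, IsTable G W D n {x | r x = v} v (t v)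

theorem isTableFamily_univ (hG : G.Preconnected) (hD : 0 < D)
    (ht : ∀ v, ∀ S < 2 ^ n, ∀ i < n + 1, t v S i = if S ≠ 0 then 0 else W i v + 1) :
    IsTableFamily G W D n univ t := by
  refine ⟨?_, id, isContraction_id G, fun v _ => ?_⟩
  · rw [coe_univ]
    exact (SimpleGraph.induceUnivIso G).symm.preconnected_iff.1 hG
  · simpa [filter_eq'] using (isTable_singleton hD v).congr (ht v)

theorem IsTableFamily.contract (h : IsTableFamily G W D n A t) (hW : ∀ v, D ≤ W n v) {p c : V}
    (hp : p ∈ A) (hc : c ∈ A) (hpc : G.Adj p c) (hleaf : ∀ w ∈ A, G.Adj c w → w = p)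
    (ht : ∀ v, ∀ S < 2 ^ n, ∀ i < n + 1,
      t' v S i = if v = p then mergeTable D n (t p) (t c) S i else t v S i) :
    IsTableFamily G W D n (A.erase c) t' := by
  obtain ⟨hA, r, hr, htable⟩ := h
  refine ⟨preconnected_induce_erase hA hp hpc.ne hleaf, _, hr.update hp hpc.ne hleaf,
    fun v hv => ?_⟩
  obtain ⟨hvc, hv⟩ := mem_erase.1 hv
  rcases eq_or_ne v p with rfl | hvp
  · have hfiber : ({x | (Function.update id c v ∘ r) x = v} : Finset V) =
        ({x | r x = v} : Finset V) ∪ ({x | r x = c} : Finset V) := by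
      ext x
      rcases eq_or_ne (r x) c with hx | hx <;> simp [hx]
    rw [hfiber]
    refine ((htable v hv).merge hW (htable c hc) ?_ ?_ ?_ hpc ?_).congr fun S hS i hi => ?_
    · exact disjoint_filter.2 fun x _ hx hx' => hvc (hx.symm.trans hx')
    · simp [hr.apply_eq v hv]
    · simp [hr.apply_eq c hc]
    · intro x hx y hy hxy
      obtain rfl : r x = v := by simpa using hx
      obtain rfl : r y = c := by simpa using hy
      exact ⟨(hr.adj x y hxy hvc).symm, (hr.adj y x hxy.symm hvc.symm).symm⟩
    · rw [ht v S hS i hi, if_pos rfl]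
  · have hfiber : ({x | (Function.update id c p ∘ r) x = v} : Finset V) =
        ({x | r x = v} : Finset V) := by
      ext x
      rcases eq_or_ne (r x) c with hx | hx <;> simp [hx, hvp.symm, hvc.symm]
    rw [hfiber]
    exact (htable v hv).congr fun S hS i hi => by rw [ht v S hS i hi, if_neg hvp]

theorem IsTableFamily.lt_served_iff {v : V} (h : IsTableFamily G W D n {v} t)
    (hW : ∀ v, D ≤ W n v) (S k : ℕ) :
    k < served D n (t v) S ↔ k = 0 ∧ Serves G W D univ (players n S) := by
  obtain ⟨-, r, hr, ht⟩ := h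
  have huniv : ({x | r x = v} : Finset V) = univ :=
    filter_true_of_mem fun x _ => mem_singleton.1 (hr.mem x)
  rw [(ht v (mem_singleton_self v)).lt_served_iff hW (by simp [huniv]), huniv]

end

end ConnectedDivision

namespace RAM

theorem size_getD_le_inputSize (l : List ℕ) (j : ℕ) : (l.getD j 0).size ≤ inputSize l := by
  rcases lt_or_ge j l.length with hj | hj
  · rw [List.getD_eq_getElem _ _ hj]
    have : lc l[j] ≤ inputSize l :=
      List.single_le_sum (by simp) _ (List.mem_map.2 ⟨_, List.getElem_mem hj, rfl⟩)
    exact (Nat.le_succ _).trans this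
  · rw [List.getD_eq_default _ _ hj, Nat.size_zero]
    exact Nat.zero_le _

theorem length_le_inputSize (l : List ℕ) : l.length ≤ inputSize l := by
  simpa [inputSize] using List.length_le_sum_of_one_le (l.map lc) (by simp [lc])

end RAM

namespace CFD

open Finset ConnectedDivision

/-! ### The input word -/

theorem getD_flatMap {α : Type*} {c : ℕ} (g : α → List ℕ) (hg : ∀ a, (g a).length = c)
    (l : List α) {i j : ℕ} (hi : i < l.length) (hj : j < c) :
    (l.flatMap g).getD (i * c + j) 0 = (g l[i]).getD j 0 := by
  induction l generalizing i with
  | nil => simp at hi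
  | cons a l ih =>
    rw [List.flatMap_cons]
    cases i with
    | zero => rw [List.getD_append _ _ _ _ (by simpa [hg])]; simp
    | succ i =>
      have hshift : (i + 1) * c + j = c + (i * c + j) := by ring
      rw [hshift, List.getD_append_right _ _ _ _ (by simp [hg]), hg, Nat.add_sub_cancel_left,
        ih (by simpa using hi)]
      rfl

theorem getD_flatMap_finRange {k c : ℕ} (g : Fin k → List ℕ) (hg : ∀ a, (g a).length = c)
    (i : Fin k) {j : ℕ} (hj : j < c) :
    ((List.finRange k).flatMap g).getD (i * c + j) 0 = (g i).getD j 0 := by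
  rw [getD_flatMap g hg _ (by simp) hj]
  simp

variable (I : CFD)

open Classical in
/-- The adjacency matrix as it is written in the input word. -/
noncomputable def adjacencyWord : List ℕ :=
  (List.finRange I.m).flatMap fun v =>
    (List.finRange I.m).map fun w => if I.graph.Adj v w then 1 else 0

/-- The utilities as they are written in the input word. -/
def utilityWord : List ℕ :=
  (List.finRange I.n).flatMap fun i =>
    (List.finRange I.m).flatMap fun v => [(I.util i v).num.toNat, (I.util i v).den]

/-- The entries of the input word after the first two, which are `n` and `m`. -/
noncomputable def cells (j : ℕ) : ℕ := (I.adjacencyWord ++ I.utilityWord).getD j 0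

theorem encode_eq : I.encode = I.n :: I.m :: (I.adjacencyWord ++ I.utilityWord) := by
  simp [encode, adjacencyWord, utilityWord]

theorem length_adjacencyWord : I.adjacencyWord.length = I.m * I.m := by
  simp [adjacencyWord, List.length_flatMap]

theorem length_utilityWord : I.utilityWord.length = 2 * (I.n * I.m) := by
  simp [utilityWord, List.length_flatMap, mul_comm 2, mul_assoc]

open Classical in
theorem cells_adjacency (v w : Fin I.m) :
    I.cells (v * I.m + w) = if I.graph.Adj v w then 1 else 0 := by
  have hlt : (v * I.m + w : ℕ) < I.adjacencyWord.length := by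
    rw [length_adjacencyWord, mul_comm (v : ℕ)]
    exact Nat.mul_add_lt_mul_of_lt_of_lt v.2 w.2
  rw [cells, List.getD_append _ _ _ _ hlt, adjacencyWord,
    getD_flatMap_finRange _ (by simp) v w.2]
  simp [List.getD_eq_getElem?_getD]

theorem cells_utility (i : Fin I.n) (v : Fin I.m) {j : ℕ} (hj : j < 2) :
    I.cells (I.m * I.m + (2 * (i * I.m + v) + j)) =
      [(I.util i v).num.toNat, (I.util i v).den].getD j 0 := by
  have hidx : 2 * (i * I.m + v : ℕ) + j = i * (I.m * 2) + (v * 2 + j) := by ring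
  rw [cells, List.getD_append_right _ _ _ _ (by simp [length_adjacencyWord]),
    length_adjacencyWord, Nat.add_sub_cancel_left, hidx, utilityWord,
    getD_flatMap_finRange _ (by simp [List.length_flatMap]) i (by omega),
    getD_flatMap_finRange (c := 2) _ (fun _ => rfl) v hj]

theorem cells_num (i : Fin I.n) (v : Fin I.m) :
    I.cells (I.m * I.m + 2 * (i * I.m + v)) = (I.util i v).num.toNat :=
  I.cells_utility i v (j := 0) two_pos

theorem cells_den (i : Fin I.n) (v : Fin I.m) :
    I.cells (I.m * I.m + (2 * (i * I.m + v) + 1)) = (I.util i v).den :=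
  I.cells_utility i v one_lt_two

/-! ### Integral weights -/

/-- A common denominator of all utilities. -/
def commonDen : ℕ := ∏ i, ∏ v, (I.util i v).den

theorem commonDen_pos : 0 < I.commonDen := prod_pos fun _ _ => prod_pos fun _ _ => Rat.den_pos _

theorem den_dvd_commonDen (i : Fin I.n) (v : Fin I.m) : (I.util i v).den ∣ I.commonDen :=
  (dvd_prod_of_mem (fun v => (I.util i v).den) (mem_univ v)).trans
    (dvd_prod_of_mem (fun i => ∏ v, (I.util i v).den) (mem_univ i))

theorem prod_cells_eq_commonDen :
    ∏ j ∈ range (I.n * I.m), I.cells (I.m * I.m + (2 * j + 1)) = I.commonDen := by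
  rw [Finset.prod_range, ← finProdFinEquiv.prod_comp, Fintype.prod_prod_type, commonDen]
  refine prod_congr rfl fun i _ => prod_congr rfl fun v _ => ?_
  rw [← cells_den, finProdFinEquiv_apply_val, add_comm (v : ℕ), mul_comm (i : ℕ)]

/-- The utilities multiplied by the number of players and by the common denominator. The additional
player `n` gives the weight `commonDen` to every item. -/
def weight (i : ℕ) (v : Fin I.m) : ℕ :=
  if h : i < I.n then
    I.commonDen / (I.util ⟨i, h⟩ v).den * (I.util ⟨i, h⟩ v).num.toNat * I.n
  else I.commonDen

theorem weight_n (v : Fin I.m) : I.weight I.n v = I.commonDen := dif_neg (lt_irrefl _)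

theorem cast_weight (i : Fin I.n) (v : Fin I.m) :
    (I.weight i v : ℚ) = I.commonDen * I.n * I.util i v := by
  have hnum : ((I.util i v).num.toNat : ℚ) = (I.util i v).num := by
    exact_mod_cast Int.toNat_of_nonneg (Rat.num_nonneg.2 (I.util_nonneg i v))
  have hden : ((I.util i v).den : ℚ) ≠ 0 := by exact_mod_cast (I.util i v).den_ne_zero
  rw [weight, dif_pos i.2, Fin.eta, Nat.cast_mul, Nat.cast_mul,
    Nat.cast_div (I.den_dvd_commonDen i v) hden, hnum]
  conv_rhs => rw [← Rat.num_div_den (I.util i v)]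
  field_simp

theorem proportional_iff (i : Fin I.n) (X : Finset (Fin I.m)) :
    (1 : ℚ) / I.n ≤ I.bundleUtil i X ↔ I.commonDen ≤ ∑ v ∈ X, I.weight i v := by
  have hn : (0 : ℚ) < I.n := by exact_mod_cast i.pos
  have hD : (0 : ℚ) < I.commonDen := by exact_mod_cast I.commonDen_pos
  rw [← Nat.cast_le (α := ℚ), Nat.cast_sum, bundleUtil]
  simp only [cast_weight]
  rw [← Finset.mul_sum, div_le_iff₀ hn, mul_assoc, le_mul_iff_one_le_right hD, mul_comm]

theorem hasPropAllocation_iff :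
    I.HasPropAllocation ↔ Serves I.graph I.weight I.commonDen univ (range I.n) := by
  constructor
  · rintro ⟨π, ⟨hconn, hdisj⟩, hprop⟩
    refine ⟨fun j => if h : j < I.n then π ⟨j, h⟩ else ∅, fun j hj => ?_, fun j hj l hl hjl => ?_⟩
    · rw [mem_range] at hj
      simp only [hj, dif_pos]
      exact ⟨subset_univ _, hconn ⟨j, hj⟩, (I.proportional_iff ⟨j, hj⟩ _).1 (hprop ⟨j, hj⟩)⟩
    · rw [mem_coe, mem_range] at hj hl
      simp only [Function.onFun, hj, hl, dif_pos]
      exact hdisj _ _ (by simpa using hjl)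
  · rintro ⟨π, hπ, hdisj⟩
    refine ⟨fun i => π i, ⟨fun i => (hπ i (by simp)).2.1, fun i j hij => ?_⟩, fun i => ?_⟩
    · exact hdisj (by simp) (by simp) fun h => hij (Fin.ext h)
    · exact (I.proportional_iff i _).2 (hπ i (by simp)).2.2

end CFD

namespace ConnectedDivision

/-! ### Storing one table per vertex in an array -/

/-- The position of the entry for the players `S` and the player `i` in the table of the vertex
`v`. -/
def tableIndex (n v S i : ℕ) : ℕ := (v * 2 ^ n + S) * (n + 1) + i

/-- The table of the vertex `v` in the array `T`. -/
def table (n : ℕ) (T : ℕ → ℕ) (v S i : ℕ) : ℕ := T (tableIndex n v S i)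

/-- The vertex to whose table the position `x` belongs. -/
def vertexAt (n x : ℕ) : ℕ := x / (n + 1) / 2 ^ n

/-- The code of the set of players to which the position `x` belongs. -/
def codeAt (n x : ℕ) : ℕ := x / (n + 1) % 2 ^ n

/-- The player to whom the position `x` belongs. -/
def playerAt (n x : ℕ) : ℕ := x % (n + 1)

section

variable {m n v S i : ℕ}

theorem tableIndex_lt (hv : v < m) (hS : S < 2 ^ n) (hi : i < n + 1) :
    tableIndex n v S i < m * 2 ^ n * (n + 1) := by
  rw [tableIndex, mul_comm _ (n + 1), mul_comm v]
  exact Nat.mul_add_lt_mul_of_lt_of_lt (Nat.mul_add_lt_mul_of_lt_of_lt hv hS) hi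

theorem tableIndex_div (S : ℕ) (hi : i < n + 1) : tableIndex n v S i / (n + 1) = v * 2 ^ n + S := by
  rw [tableIndex, mul_comm, Nat.mul_add_div n.succ_pos, Nat.div_eq_of_lt hi, add_zero]

theorem vertexAt_tableIndex (hS : S < 2 ^ n) (hi : i < n + 1) :
    vertexAt n (tableIndex n v S i) = v := by
  rw [vertexAt, tableIndex_div S hi, mul_comm, Nat.mul_add_div (by positivity),
    Nat.div_eq_of_lt hS, add_zero]

theorem codeAt_tableIndex (hS : S < 2 ^ n) (hi : i < n + 1) :
    codeAt n (tableIndex n v S i) = S := by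
  rw [codeAt, tableIndex_div S hi, Nat.mul_add_mod_of_lt hS]

theorem playerAt_tableIndex (S : ℕ) (hi : i < n + 1) : playerAt n (tableIndex n v S i) = i :=
  Nat.mul_add_mod_of_lt hi

theorem vertexAt_lt {x : ℕ} (hx : x < m * 2 ^ n * (n + 1)) : vertexAt n x < m := by
  rw [mul_assoc, mul_comm (2 ^ n)] at hx
  rw [vertexAt, Nat.div_div_eq_div_mul]
  exact Nat.div_lt_of_lt_mul (by rwa [mul_comm] at hx)

end

end ConnectedDivision

namespace CFD

open ConnectedDivision RAM Routine

/-! ### Expressions of the solver -/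

/- Variables of the solver. The answer is in variable `0`, whose address is the cell `0` that holds
the output of the machine; `xN`, `xM` and `xDen` keep the numbers of players and vertices and the
common denominator from the reading of the input on. The other variables serve loops, and the
contraction of `xChild` into `xParent`. -/
abbrev xOut : ℕ := 0
abbrev xN : ℕ := 1
abbrev xM : ℕ := 2
abbrev xDen : ℕ := 3
abbrev xChild : ℕ := 4
abbrev xParent : ℕ := 5
abbrev xPos : ℕ := 6
abbrev xLeft : ℕ := 7
abbrev xRight : ℕ := 8
abbrev xPlayer : ℕ := 9
abbrev xBit : ℕ := 10
abbrev xExp : ℕ := 11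
abbrev xVertex : ℕ := 12
abbrev xNeighbor : ℕ := 13
abbrev xRound : ℕ := 14
abbrev xTemp : ℕ := 15

/- Arrays of the solver: the input after its first two numbers, the tables of all vertices, the new
tables while they are computed from the old ones, and the indicator function of the set of vertices
that have not yet been contracted. -/
abbrev aIn : Fin 4 := 0
abbrev aTable : Fin 4 := 1
abbrev aNew : Fin 4 := 2
abbrev aAlive : Fin 4 := 3

/-- `M` bounds the loop counts of the solver on `I` and the sizes of the input numbers. -/
structure IsBound (I : CFD) (M : ℕ) : Prop where
  two_le : 2 ≤ M
  length_le : I.m * I.m + 2 * (I.n * I.m) ≤ M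
  table_le : (I.m + 1) * 2 ^ I.n * (I.n + 1) ≤ M
  size_le : ∀ j, (I.encode.getD j 0).size ≤ M

/-- The data of `I` are in their variables and in the array `aIn`. -/
structure Loaded (I : CFD) (s : Env) : Prop where
  var_n : s.var xN = I.n
  var_m : s.var xM = I.m
  var_den : s.var xDen = I.commonDen
  arr_cells : ∀ j < I.m * I.m + 2 * (I.n * I.m), s.arr aIn j = I.cells j

noncomputable section

/-- The number of entries of all tables. -/
def tableSizeExpr : Routine := var xM * twoPow xExp (var xN) * (var xN + lit 1)

/-- The entry for the players `S` and the player `i` in the table of the vertex `v`. -/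
def entryExpr (v S i : Routine) : Routine :=
  arr aTable ((v * twoPow xExp (var xN) + S) * (var xN + lit 1) + i)

/-- The vertex to whose table the position `xPos` belongs. -/
def vertexExpr : Routine := var xPos / (var xN + lit 1) / twoPow xExp (var xN)

/-- The code of the set of players to which the position `xPos` belongs. -/
def codeExpr : Routine := mod (var xPos / (var xN + lit 1)) (twoPow xExp (var xN))

/-- The player to whom the position `xPos` belongs. -/
def playerExpr : Routine := mod (var xPos) (var xN + lit 1)

/-- The number of players encoded by `S` but neither by `S₁` nor by `S₂`. -/
def uncoveredExpr (S S₁ S₂ : Routine) : Routine :=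
  sum xBit (var xN)
    (testBit xExp S (var xBit) - (testBit xExp S₁ (var xBit) + testBit xExp S₂ (var xBit)))

/-- Whether all players encoded by `S` can be served, according to the table of the vertex `v`. -/
def servedExpr (v S : Routine) : Routine :=
  sup xPlayer (var xN + lit 1) <| sup xLeft (twoPow xExp (var xN)) <|
    ite (uncoveredExpr S (var xLeft) (twoPow xExp (var xPlayer))) (lit 0)
      (ite (entryExpr v (var xLeft) (var xPlayer) - var xDen) (lit 1) (lit 0))

/-- The sum of two weights in the encoding of `joined`. -/
def joinedExpr (e f : Routine) : Routine := ite e (ite f (e + f - lit 1) (lit 0)) (lit 0)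

/-- The entry at the position `xPos` of the table that arises when `xChild` is contracted into
`xParent`. -/
def mergeExpr : Routine :=
  sup xLeft (twoPow xExp (var xN)) <| sup xRight (twoPow xExp (var xN)) <|
    ite (uncoveredExpr codeExpr (var xLeft) (var xRight)) (lit 0)
      (joinedExpr (entryExpr (var xParent) (var xLeft) playerExpr)
        (op .max (entryExpr (var xChild) (var xRight) playerExpr)
          (servedExpr (var xChild) (var xRight))))

section

variable {I : CFD} {M : ℕ} {s : Env}

namespace IsBound

variable (hM : I.IsBound M)

include hM

theorem succ_n_le : I.n + 1 ≤ M := hM.table_le.trans' (Nat.le_mul_of_pos_left _ (by positivity))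

theorem n_le : I.n ≤ M := I.n.le_succ.trans hM.succ_n_le

theorem two_pow_le : 2 ^ I.n ≤ M :=
  hM.table_le.trans' <| (Nat.le_mul_of_pos_left _ I.m.succ_pos).trans
    (Nat.le_mul_of_pos_right _ I.n.succ_pos)

theorem tableSize_le : I.m * 2 ^ I.n * (I.n + 1) ≤ M :=
  hM.table_le.trans' (by gcongr; exact I.m.le_succ)

theorem m_le : I.m ≤ M := (Nat.le_mul_self I.m).trans (le_self_add.trans hM.length_le)

theorem size_cells_le (j : ℕ) : (I.cells j).size ≤ M := by
  simpa [encode_eq, cells] using hM.size_le (j + 2)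

end IsBound

theorem Loaded.setVar (hs : I.Loaded s) {x : ℕ} (hx : 3 < x) (y : ℕ) : I.Loaded (s.setVar x y) where
  var_n := (Function.update_of_ne (by unfold xN; omega) ..).trans hs.var_n
  var_m := (Function.update_of_ne (by unfold xM; omega) ..).trans hs.var_m
  var_den := (Function.update_of_ne (by unfold xDen; omega) ..).trans hs.var_den
  arr_cells := hs.arr_cells

theorem Loaded.setArr (hs : I.Loaded s) {k : Fin 4} (hk : k ≠ aIn) (g : ℕ → ℕ) :
    I.Loaded (s.setArr k g) where
  var_n := hs.var_n
  var_m := hs.var_m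
  var_den := hs.var_den
  arr_cells := by simpa [Function.update_of_ne hk.symm] using hs.arr_cells

variable (hM : I.IsBound M) (hs : I.Loaded s)

include hs

theorem Loaded.computes_n : (var xN).Computes M s I.n := hs.var_n ▸ computes_var xN

theorem Loaded.computes_m : (var xM).Computes M s I.m := hs.var_m ▸ computes_var xM

theorem Loaded.computes_den : (var xDen).Computes M s I.commonDen := hs.var_den ▸ computes_var xDen

theorem Loaded.computes_succ_n : (var xN + lit 1).Computes M s (I.n + 1) :=
  hs.computes_n.add (computes_lit 1)

include hM

theorem Loaded.computes_two_pow : (twoPow xExp (var xN)).Computes M s (2 ^ I.n) :=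
  hs.computes_n.twoPow hM.n_le hM.two_le

theorem computes_tableSizeExpr : tableSizeExpr.Computes M s (I.m * 2 ^ I.n * (I.n + 1)) :=
  (hs.computes_m.mul (hs.computes_two_pow hM) ((size_le_self _).trans hM.two_pow_le)).mul
    hs.computes_succ_n ((size_le_self _).trans hM.succ_n_le)

theorem computes_entryExpr {e f g : Routine} {v S i : ℕ} (he : e.Computes M s v)
    (hf : f.Computes M s S) (hg : g.Computes M s i) :
    (entryExpr e f g).Computes M s (table I.n (s.arr aTable) v S i) :=
  .arr aTable <| (((he.mul (hs.computes_two_pow hM)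
    ((size_le_self _).trans hM.two_pow_le)).add hf).mul
    hs.computes_succ_n ((size_le_self _).trans hM.succ_n_le)).add hg

theorem computes_vertexExpr : vertexExpr.Computes M s (vertexAt I.n (s.var xPos)) :=
  ((computes_var xPos).div hs.computes_succ_n).div (hs.computes_two_pow hM)

theorem computes_codeExpr : codeExpr.Computes M s (codeAt I.n (s.var xPos)) :=
  ((computes_var xPos).div hs.computes_succ_n).mod (hs.computes_two_pow hM)
    ((size_le_self _).trans hM.two_pow_le)

theorem computes_playerExpr : playerExpr.Computes M s (playerAt I.n (s.var xPos)) :=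
  (computes_var xPos).mod hs.computes_succ_n ((size_le_self _).trans hM.succ_n_le)

theorem computes_uncoveredExpr {e e₁ e₂ : Routine} {S S₁ S₂ : ℕ}
    (he : ∀ j, e.Computes M (s.setVar xBit j) S) (he₁ : ∀ j, e₁.Computes M (s.setVar xBit j) S₁)
    (he₂ : ∀ j, e₂.Computes M (s.setVar xBit j) S₂) :
    (uncoveredExpr e e₁ e₂).Computes M s (uncovered I.n S S₁ S₂) := by
  refine hs.computes_n.sum hM.n_le fun j hj => ?_
  have hbit {e : Routine} {S : ℕ} (he : e.Computes M (s.setVar xBit j) S) :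
      (testBit xExp e (var xBit)).Computes M (s.setVar xBit j) (S.testBit j).toNat :=
    he.testBit (computes_var xBit) (hj.le.trans hM.n_le) hM.two_le
  exact (hbit (he j)).sub ((hbit (he₁ j)).add (hbit (he₂ j)))

theorem computes_servedExpr {e f : Routine} {v S : ℕ}
    (he : ∀ i a, e.Computes M ((s.setVar xPlayer i).setVar xLeft a) v)
    (hf : ∀ i a j, f.Computes M (((s.setVar xPlayer i).setVar xLeft a).setVar xBit j) S) :
    (servedExpr e f).Computes M s (served I.commonDen I.n (table I.n (s.arr aTable) v) S) := by
  refine hs.computes_succ_n.sup hM.succ_n_le fun i hi => ?_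
  have hsO := hs.setVar (by decide : 3 < xPlayer) i
  refine (hsO.computes_two_pow hM).sup hM.two_pow_le fun S₁ _ => ?_
  have hsA := hsO.setVar (by decide : 3 < xLeft) S₁
  refine (computes_uncoveredExpr hM hsA (hf i S₁) (fun _ => computes_var xLeft) fun j => ?_).ite
    (fun _ => computes_lit 0) fun _ => ((computes_entryExpr hM hsA (he i S₁) (computes_var xLeft)
      (computes_var xPlayer)).sub hsA.computes_den).ite (fun _ => computes_lit 1)
      fun _ => computes_lit 0
  exact (computes_var xPlayer).twoPow (hi.le.trans hM.succ_n_le) hM.two_le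

omit hM hs in
theorem computes_joinedExpr {e f : Routine} {x y : ℕ} (he : e.Computes M s x)
    (hf : f.Computes M s y) : (joinedExpr e f).Computes M s (joined x y) :=
  he.ite (fun _ => hf.ite (fun _ => (he.add hf).sub (computes_lit 1)) fun _ => computes_lit 0)
    fun _ => computes_lit 0

theorem computes_mergeExpr :
    mergeExpr.Computes M s
      (mergeTable I.commonDen I.n (table I.n (s.arr aTable) (s.var xParent))
        (table I.n (s.arr aTable) (s.var xChild)) (codeAt I.n (s.var xPos))
        (playerAt I.n (s.var xPos))) := by
  refine (hs.computes_two_pow hM).sup hM.two_pow_le fun S₁ _ => ?_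
  have hsA := hs.setVar (by decide : 3 < xLeft) S₁
  refine (hsA.computes_two_pow hM).sup hM.two_pow_le fun S₂ _ => ?_
  have hsB := hsA.setVar (by decide : 3 < xRight) S₂
  have hcode : ∀ j, codeExpr.Computes M (((s.setVar xLeft S₁).setVar xRight S₂).setVar xBit j)
      (codeAt I.n (s.var xPos)) :=
    fun j => computes_codeExpr hM (hsB.setVar (by decide : 3 < xBit) j)
  have hplayer := computes_playerExpr hM hsB
  exact (computes_uncoveredExpr hM hsB hcode (fun _ => computes_var xLeft)
    fun _ => computes_var xRight).ite (fun _ => computes_lit 0) fun _ => computes_joinedExpr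
    (computes_entryExpr hM hsB (computes_var xParent) (computes_var xLeft) hplayer) <|
    (computes_entryExpr hM hsB (computes_var xChild) (computes_var xRight) hplayer).op .max
      (computes_servedExpr hM hsB (fun _ _ => computes_var xChild) fun _ _ _ => computes_var xRight)
      (by simp)

end

end

end CFD

namespace CFD

open ConnectedDivision RAM Routine

/-! ### The solver -/

variable {I : CFD} {M : ℕ} {s : Env} {Q : Env → Prop}

noncomputable section

/-- The next input numbers, in the number given by `N`, are read into the array `aIn`. -/
def readCells (N : Routine) : Routine :=
  loop xRound N ((read xTemp).seq (write aIn (var xRound) (var xTemp)))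

theorem ensures_readCells {N : Routine} {k : ℕ} (hN : N.Computes M s k) (hk : k ≤ M)
    (hM : ∀ j, (s.input.getD j 0).size ≤ M)
    (hQ : ∀ t : Env, (∀ x, x ≠ xTemp → t.var x = s.var x) →
      (∀ j < k, t.arr aIn j = s.input.getD j 0) → Q t) :
    (readCells N).Ensures M s Q := by
  refine Ensures.loop (fun r t => (∀ x, x ≠ xTemp → x ≠ xRound → t.var x = s.var x) ∧
    t.input = s.input.drop r ∧ ∀ j < r, t.arr aIn j = s.input.getD j 0) hN hk (by simp) ?_ ?_
  · rintro r - t ⟨hvar, hinput, harr⟩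
    have hhead : t.input.headD 0 = s.input.getD r 0 := by
      simp [hinput, List.headD_eq_head?_getD, List.getD_eq_getElem?_getD, List.head?_drop]
    refine ensures_read_seq ((congrArg Nat.size hhead).trans_le (hM r)) ?_
    refine Ensures.write (computes_var xRound) (computes_var xTemp)
      ⟨fun x hC hR => ?_, ?_, fun j hj => ?_⟩
    · simp [hC, hR, hvar x hC hR]
    · simp [hinput]
    · rcases Nat.lt_succ_iff_lt_or_eq.1 hj with hj | rfl
      · simp [hj.ne, harr j hj]
      · exact (Function.update_self ..).trans hhead
  · rintro t ⟨hvar, -, harr⟩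
    refine hQ _ (fun x hx => ?_) harr
    rcases eq_or_ne x xRound with rfl | hR
    · simp
    · simp [hR, hvar x hx hR]

/-- All tables are replaced by the one whose entry at the position `xPos` is the value of `e`. The
new entries are collected in the array `aNew`, since `e` may depend on all old ones. -/
def retabulate (e : Routine) : Routine :=
  (tabulate aNew xPos tableSizeExpr e).seq
    (tabulate aTable xPos tableSizeExpr (arr aNew (var xPos)))

theorem ensures_retabulate (hM : I.IsBound M) (hs : I.Loaded s) {e : Routine}
    {t : Fin I.m → ℕ → ℕ → ℕ}
    (he : ∀ u x (v : Fin I.m), vertexAt I.n x = v → e.Computes M ((s.setArr aNew u).setVar xPos x)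
      (t v (codeAt I.n x) (playerAt I.n x)))
    (hQ : ∀ u a, (∀ v : Fin I.m, ∀ S < 2 ^ I.n, ∀ i < I.n + 1, table I.n a v S i = t v S i) →
      Q ((s.setArr aNew u).setArr aTable a)) :
    (retabulate e).Ensures M s Q := by
  let g (x : ℕ) : ℕ := if h : vertexAt I.n x < I.m then
    t ⟨_, h⟩ (codeAt I.n x) (playerAt I.n x) else 0
  refine Ensures.seq (Q' := fun s' => ∃ u,
    (∀ x < I.m * 2 ^ I.n * (I.n + 1), u x = g x) ∧ s' = s.setArr aNew u) ?_ ?_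
  · refine Ensures.tabulate (computes_tableSizeExpr hM hs) hM.tableSize_le (fun x hx u => ?_)
      fun u hu => ⟨u, hu, rfl⟩
    simpa only [g, dif_pos (vertexAt_lt hx)] using he u x ⟨_, vertexAt_lt hx⟩ rfl
  · rintro _ ⟨u, hu, rfl⟩
    have hsU := hs.setArr (by decide : aNew ≠ aIn) u
    refine Ensures.tabulate (computes_tableSizeExpr hM hsU) hM.tableSize_le
      (fun x _ a => (computes_var xPos).arr aNew) fun a ha => hQ u a fun v S hS i hi => ?_
    have hx := tableIndex_lt v.2 hS hi
    have hv := vertexAt_tableIndex (v := v) hS hi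
    rw [table, ha _ hx]
    simp [hu _ hx, g, hv, codeAt_tableIndex hS hi, playerAt_tableIndex S hi]

/-- The numerator (`j = 0`) or the denominator (`j = 1`) of the utility to which the position `xPos`
belongs. -/
def utilityExpr (j : ℕ) : Routine :=
  arr aIn (var xM * var xM + (lit 2 * (playerExpr * var xM + vertexExpr) + lit j))

theorem computes_utilityExpr (hM : I.IsBound M) (hs : I.Loaded s) {i : Fin I.n} {v : Fin I.m}
    (hi : playerAt I.n (s.var xPos) = i) (hv : vertexAt I.n (s.var xPos) = v) {j : ℕ} (hj : j < 2) :
    (utilityExpr j).Computes M s ([(I.util i v).num.toNat, (I.util i v).den].getD j 0) := by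
  have hlt : (i * I.m + v : ℕ) < I.n * I.m := by
    rw [mul_comm (i : ℕ)]
    exact Nat.mul_add_lt_mul_of_lt_of_lt i.2 v.2
  have hm : (I.m).size ≤ M := (size_le_self _).trans hM.m_le
  have hindex : (I.n * I.m).size ≤ M :=
    (size_le_self _).trans ((by omega : I.n * I.m ≤ _).trans hM.length_le)
  have hplayer := hi ▸ computes_playerExpr hM hs
  have hvertex := hv ▸ computes_vertexExpr hM hs
  rw [← cells_utility I i v hj, ← hs.arr_cells _ (by omega)]
  exact .arr aIn <| (hs.computes_m.mul hs.computes_m hm).add <|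
    ((computes_lit 2).mul ((hplayer.mul hs.computes_m hm).add hvertex)
      ((Nat.size_le_size hlt.le).trans hindex)).add (computes_lit j)

/-- The weight to which the position `xPos` belongs. -/
def weightExpr : Routine :=
  ite (var xN - playerExpr) (var xDen / utilityExpr 1 * utilityExpr 0 * var xN) (var xDen)

theorem computes_weightExpr (hM : I.IsBound M) (hs : I.Loaded s) {v : Fin I.m}
    (hv : vertexAt I.n (s.var xPos) = v) :
    weightExpr.Computes M s (I.weight (playerAt I.n (s.var xPos)) v) := by
  have hplayer := hs.computes_n.sub (computes_playerExpr hM hs)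
  by_cases hi : playerAt I.n (s.var xPos) < I.n
  · have hutil {j : ℕ} (hj : j < 2) := computes_utilityExpr hM hs (i := ⟨_, hi⟩) rfl hv hj
    have hnum : ((I.util ⟨_, hi⟩ v).num.toNat).size ≤ M :=
      cells_num I ⟨_, hi⟩ v ▸ hM.size_cells_le _
    rw [weight, dif_pos hi]
    exact hplayer.ite_ne_zero (Nat.sub_ne_zero_of_lt hi) <|
      ((hs.computes_den.div (hutil one_lt_two)).mul (hutil two_pos) hnum).mul hs.computes_n
        ((size_le_self _).trans hM.n_le)
  · rw [Nat.sub_eq_zero_of_le (not_lt.1 hi)] at hplayer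
    rw [weight, dif_neg hi]
    exact hplayer.ite_zero hs.computes_den

/-- The entry at the position `xPos` of the table of a single vertex. -/
def singletonExpr : Routine := ite codeExpr (lit 0) (weightExpr + lit 1)

theorem computes_singletonExpr (hM : I.IsBound M) (hs : I.Loaded s) {v : Fin I.m}
    (hv : vertexAt I.n (s.var xPos) = v) :
    singletonExpr.Computes M s (if codeAt I.n (s.var xPos) ≠ 0 then 0 else
      I.weight (playerAt I.n (s.var xPos)) v + 1) :=
  (computes_codeExpr hM hs).ite (fun _ => computes_lit 0)
    fun _ => (computes_weightExpr hM hs hv).add (computes_lit 1)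

/-- The entry at the position `xPos` of the new table when `xChild` is contracted into `xParent`. -/
def contractExpr : Routine :=
  ifEq vertexExpr (var xParent) mergeExpr (entryExpr vertexExpr codeExpr playerExpr)

theorem computes_contractExpr (hM : I.IsBound M) (hs : I.Loaded s) :
    contractExpr.Computes M s
      (if vertexAt I.n (s.var xPos) = s.var xParent then
        mergeTable I.commonDen I.n (table I.n (s.arr aTable) (s.var xParent))
          (table I.n (s.arr aTable) (s.var xChild)) (codeAt I.n (s.var xPos))
          (playerAt I.n (s.var xPos))
      else table I.n (s.arr aTable) (vertexAt I.n (s.var xPos)) (codeAt I.n (s.var xPos))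
        (playerAt I.n (s.var xPos))) :=
  (computes_vertexExpr hM hs).ifEq (computes_var xParent) (fun _ => computes_mergeExpr hM hs)
    fun _ => computes_entryExpr hM hs (computes_vertexExpr hM hs) (computes_codeExpr hM hs)
      (computes_playerExpr hM hs)

/-- The product of all denominators in the input. -/
def denExpr : Routine :=
  prod xPos (var xN * var xM) (arr aIn (var xM * var xM + (lit 2 * var xPos + lit 1)))

theorem computes_denExpr (hM : I.IsBound M) (hn : s.var xN = I.n) (hm : s.var xM = I.m)
    (hcells : ∀ j < I.m * I.m + 2 * (I.n * I.m), s.arr aIn j = I.cells j) :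
    denExpr.Computes M s I.commonDen := by
  have hmM : (I.m).size ≤ M := (size_le_self _).trans hM.m_le
  have hlen := hM.length_le
  have hN : (var xN).Computes M s I.n := hn ▸ computes_var xN
  have hX (j : ℕ) : (var xM).Computes M (s.setVar xPos j) I.m := hm ▸ computes_var xM
  rw [← prod_cells_eq_commonDen]
  refine Computes.prod (hN.mul (hm ▸ computes_var xM) hmM) (by omega) (fun j hj => ?_)
    fun j _ => hM.size_cells_le _
  rw [← hcells _ (by omega)]
  exact .arr aIn <| ((hX j).mul (hX j) hmM).add <|
    ((computes_lit 2).mul (computes_var xPos) ((size_le_self j).trans (by omega))).add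
      (computes_lit 1)

end

end CFD

namespace CFD

open Finset ConnectedDivision RAM Routine

/-! ### Elimination of leaves -/

open Classical in
/-- The number of neighbours of `v` in `A`. -/
noncomputable def degreeIn (I : CFD) (A : Finset (Fin I.m)) (v : Fin I.m) : ℕ :=
  #{w ∈ A | I.graph.Adj v w}

/-- The array `aAlive` is the indicator function of `A`. -/
def IsAlive (I : CFD) (A : Finset (Fin I.m)) (s : Env) : Prop :=
  ∀ v : Fin I.m, s.arr aAlive v = if v ∈ A then 1 else 0

variable {I : CFD} {M : ℕ} {s : Env} {A : Finset (Fin I.m)}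

theorem degreeIn_eq_one_iff {v : Fin I.m} :
    I.degreeIn A v = 1 ↔ ∃! w, w ∈ A ∧ I.graph.Adj v w := by
  simp [degreeIn, card_eq_one, singleton_iff_unique_mem]

noncomputable section

/-- Whether the vertices `e` and `f` are adjacent. -/
def adjacencyExpr (e f : Routine) : Routine := arr aIn (e * var xM + f)

/-- The sum of the values of `e` over all vertices `xNeighbor` in the set held in `aAlive`. -/
def aliveSum (e : Routine) : Routine :=
  Routine.sum xNeighbor (var xM) (arr aAlive (var xNeighbor) * e)

/-- The number of neighbours of the vertex `e` in the set held in `aAlive`. -/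
def degreeExpr (e : Routine) : Routine := aliveSum (adjacencyExpr e (var xNeighbor))

/-- The only neighbour of the vertex `e` in the set held in `aAlive`. -/
def neighborExpr (e : Routine) : Routine :=
  aliveSum (adjacencyExpr e (var xNeighbor) * var xNeighbor)

/-- A vertex with only one neighbour in the set held in `aAlive`. -/
def leafExpr : Routine :=
  Routine.sup xVertex (var xM) (ite (arr aAlive (var xVertex))
    (ifEq (degreeExpr (var xVertex)) (lit 1) (var xVertex + lit 1) (lit 0)) (lit 0)) - lit 1

section

variable (hM : I.IsBound M) (hs : I.Loaded s)

include hM hs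

open Classical in
theorem computes_adjacencyExpr {e f : Routine} {v w : Fin I.m} (he : e.Computes M s v)
    (hf : f.Computes M s w) :
    (adjacencyExpr e f).Computes M s (if I.graph.Adj v w then 1 else 0) := by
  have hlt : (v * I.m + w : ℕ) < I.m * I.m := by
    rw [mul_comm (v : ℕ)]
    exact Nat.mul_add_lt_mul_of_lt_of_lt v.2 w.2
  rw [← cells_adjacency, ← hs.arr_cells _ (by omega)]
  exact .arr aIn <| (he.mul hs.computes_m ((size_le_self _).trans hM.m_le)).add hf

variable (hA : I.IsAlive A s)

include hA

theorem computes_aliveSum {e : Routine} {g : Fin I.m → ℕ}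
    (he : ∀ w : Fin I.m, e.Computes M (s.setVar xNeighbor w) (g w)) (hg : ∀ w, (g w).size ≤ M) :
    (aliveSum e).Computes M s (∑ w ∈ A, g w) := by
  let h (j : ℕ) : ℕ := if hj : j < I.m then (if ⟨j, hj⟩ ∈ A then 1 else 0) * g ⟨j, hj⟩ else 0
  have hsum : ∑ w ∈ A, g w = ∑ j ∈ range I.m, h j := by
    simp [sum_range, h]
  rw [hsum]
  refine hs.computes_m.sum hM.m_le fun j hj => ?_
  simp only [h, dif_pos hj, ← hA ⟨j, hj⟩]
  exact ((computes_var xNeighbor).arr aAlive).mul (he ⟨j, hj⟩) (hg _)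

theorem computes_degreeExpr {e : Routine} {v : Fin I.m}
    (he : ∀ j, e.Computes M (s.setVar xNeighbor j) v) :
    (degreeExpr e).Computes M s (I.degreeIn A v) := by
  classical
  rw [degreeIn, card_filter]
  refine computes_aliveSum hM hs hA (fun w => ?_) fun w => ?_
  · exact computes_adjacencyExpr hM (hs.setVar (by decide) _) (he w) (computes_var xNeighbor)
  · rw [← cells_adjacency]
    exact hM.size_cells_le _

theorem computes_neighborExpr {e : Routine} {v w : Fin I.m}
    (he : ∀ j, e.Computes M (s.setVar xNeighbor j) v) (hw : w ∈ A ∧ I.graph.Adj v w)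
    (hunique : ∀ x ∈ A, I.graph.Adj v x → x = w) : (neighborExpr e).Computes M s w := by
  classical
  have hsum : (w : ℕ) = ∑ x ∈ A, (if I.graph.Adj v x then 1 else 0) * (x : ℕ) := by
    rw [sum_eq_single_of_mem w hw.1 fun x hx hxw => ?_, if_pos hw.2, one_mul]
    rw [if_neg fun h => hxw (hunique x hx h), zero_mul]
  have hsize (x : Fin I.m) : (x : ℕ).size ≤ M :=
    (size_le_self _).trans (x.2.le.trans hM.m_le)
  rw [hsum]
  refine computes_aliveSum hM hs hA (fun x => ?_) fun x => ?_
  · exact (computes_adjacencyExpr hM (hs.setVar (by decide) _) (he x) (computes_var xNeighbor)).mul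
      (computes_var xNeighbor) (hsize x)
  · refine (Nat.size_le_size ?_).trans (hsize x)
    split_ifs <;> simp

theorem exists_computes_leafExpr (h : ∃ c ∈ A, I.degreeIn A c = 1) :
    ∃ c ∈ A, I.degreeIn A c = 1 ∧ leafExpr.Computes M s c := by
  let g (j : ℕ) : ℕ := if hj : j < I.m then
    if s.arr aAlive j ≠ 0 then if I.degreeIn A ⟨j, hj⟩ = 1 then j + 1 else 0 else 0 else 0
  have hcomputes : leafExpr.Computes M s ((range I.m).sup g - 1) := by
    refine (hs.computes_m.sup hM.m_le fun j hj => ?_).sub (computes_lit 1)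
    have hdeg := computes_degreeExpr hM (hs.setVar (by decide : 3 < xVertex) j) hA (v := ⟨j, hj⟩)
      fun _ => computes_var xVertex
    simp only [g, dif_pos hj]
    exact ((computes_var xVertex).arr aAlive).ite (fun _ => hdeg.ifEq (computes_lit 1)
      (fun _ => (computes_var xVertex).add (computes_lit 1)) fun _ => computes_lit 0)
      fun _ => computes_lit 0
  obtain ⟨c, hcA, hc⟩ := h
  obtain ⟨j, hj, hsup⟩ := exists_mem_eq_sup (range I.m) ⟨c, mem_range.2 c.2⟩ g
  have hpos : g j ≠ 0 := by
    refine (lt_of_lt_of_le ?_ ((le_sup (mem_range.2 c.2)).trans_eq hsup)).ne'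
    simp [g, hA c, hcA, hc]
  rw [mem_range] at hj
  obtain ⟨hjA, hdeg⟩ : ⟨j, hj⟩ ∈ A ∧ I.degreeIn A ⟨j, hj⟩ = 1 := by
    simpa [g, hj, hA ⟨j, hj⟩] using hpos
  refine ⟨⟨j, hj⟩, hjA, hdeg, ?_⟩
  have hgj : g j = j + 1 := by simp [g, hj, hA ⟨j, hj⟩, hjA, hdeg]
  rwa [hsup, hgj, Nat.add_sub_cancel] at hcomputes

end

/-- The vertices in `A` remain, and the array `aTable` holds their tables. -/
structure Contracted (I : CFD) (A : Finset (Fin I.m)) (s : Env) : Prop where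
  loaded : I.Loaded s
  alive : I.IsAlive A s
  family : IsTableFamily I.graph I.weight I.commonDen I.n A fun v => table I.n (s.arr aTable) v

theorem Contracted.setVar (h : I.Contracted A s) {x : ℕ} (hx : 3 < x) (y : ℕ) :
    I.Contracted A (s.setVar x y) :=
  ⟨h.loaded.setVar hx y, h.alive, h.family⟩

/-- The vertex `xChild` is contracted into the vertex `xParent`. -/
def contractEdge : Routine := (retabulate contractExpr).seq (write aAlive (var xChild) (lit 0))

theorem ensures_contractEdge (hM : I.IsBound M) (h : I.Contracted A s) {p c : Fin I.m}
    (hparent : s.var xParent = p) (hchild : s.var xChild = c) (hp : p ∈ A) (hc : c ∈ A)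
    (hcp : I.graph.Adj c p) (hleaf : ∀ w ∈ A, I.graph.Adj c w → w = p) :
    contractEdge.Ensures M s (I.Contracted (A.erase c)) := by
  have hU (u : ℕ → ℕ) := h.loaded.setArr (by decide : aNew ≠ aIn) u
  let t (v : Fin I.m) (S i : ℕ) : ℕ :=
    if v = p then
      mergeTable I.commonDen I.n (table I.n (s.arr aTable) p) (table I.n (s.arr aTable) c) S i
    else table I.n (s.arr aTable) v S i
  refine Ensures.seq (Q' := fun s' => ∃ u a, (∀ v : Fin I.m, ∀ S < 2 ^ I.n, ∀ i < I.n + 1,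
      table I.n a v S i = t v S i) ∧ s' = (s.setArr aNew u).setArr aTable a)
    (ensures_retabulate hM h.loaded (fun u x v hv => ?_) fun u a ha => ⟨u, a, ha, rfl⟩) ?_
  · have := computes_contractExpr hM ((hU u).setVar (by decide : 3 < xPos) x)
    simpa [hv, hparent, hchild, Fin.ext_iff, t] using this
  · rintro _ ⟨u, a, ha, rfl⟩
    refine Ensures.write (computes_var xChild) (computes_lit 0) ⟨?_, fun v => ?_, ?_⟩
    · exact ((hU u).setArr (by decide) a).setArr (by decide) _
    · rcases eq_or_ne v c with rfl | hvc
      · simp [hchild]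
      · simp [hchild, hvc, Fin.val_ne_of_ne hvc, aTable, aNew, aAlive, ← h.alive v]
    · exact h.family.contract (fun v => (I.weight_n v).ge) hp hc hcp.symm hleaf ha

/-- A leaf of the graph on the remaining vertices is contracted into its neighbour. -/
def contractLeaf : Routine :=
  (assign xChild leafExpr).seq ((assign xParent (neighborExpr (var xChild))).seq contractEdge)

theorem ensures_contractLeaf (hM : I.IsBound M) (hG : I.graph.IsAcyclic)
    (h : I.Contracted A s) (hcard : 1 < #A) :
    contractLeaf.Ensures M s fun s' => ∃ A', #A' + 1 = #A ∧ I.Contracted A' s' := by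
  obtain ⟨c', hc', hdeg'⟩ := exists_leaf_of_isAcyclic h.family.1 hG hcard
  obtain ⟨c, hc, hdeg, hcomputes⟩ :=
    exists_computes_leafExpr hM h.loaded h.alive ⟨c', hc', degreeIn_eq_one_iff.2 hdeg'⟩
  obtain ⟨p, ⟨hp, hcp⟩, hunique⟩ := degreeIn_eq_one_iff.1 hdeg
  have hleaf : ∀ w ∈ A, I.graph.Adj c w → w = p := fun w hw hcw => hunique w ⟨hw, hcw⟩
  have hC := h.setVar (by decide : 3 < xChild) c
  have hP := hC.setVar (by decide : 3 < xParent) p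
  refine .assign_seq hcomputes (.assign_seq (computes_neighborExpr hM hC.loaded hC.alive
    (fun _ => computes_var xChild) ⟨hp, hcp⟩ hleaf) ?_)
  exact (ensures_contractEdge hM hP rfl rfl hp hc hcp hleaf).imp fun _ h =>
    ⟨_, card_erase_add_one hc, h⟩

/-! ### The complete program -/

/-- The instance is read from the input. -/
def readInput : Routine :=
  (read xN).seq <| (read xM).seq <|
    (readCells (var xM * var xM + lit 2 * (var xN * var xM))).seq (assign xDen denExpr)

theorem ensures_readInput (hM : I.IsBound M) :
    readInput.Ensures M (.initial I.encode) I.Loaded := by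
  have hsize := hM.size_le
  simp only [encode_eq] at hsize ⊢
  refine ensures_read_seq (hsize 0) (ensures_read_seq (hsize 1) ?_)
  set s : Env := ((Env.initial _).pop xN).pop xM
  have hn : (var xN).Computes M s I.n := computes_var xN
  have hm : (var xM).Computes M s I.m := computes_var xM
  have hlen := hM.length_le
  have hm_size : (I.m).size ≤ M := (size_le_self _).trans hM.m_le
  have hcount := (hm.mul hm hm_size).add
    ((computes_lit 2).mul (hn.mul hm hm_size) ((size_le_self _).trans (by omega)))
  refine Ensures.seq (Q' := fun t => t.var xN = I.n ∧ t.var xM = I.m ∧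
    ∀ j < I.m * I.m + 2 * (I.n * I.m), t.arr aIn j = I.cells j) ?_ ?_
  · refine ensures_readCells hcount hlen (fun j => hsize (j + 2)) fun t hvar harr => ?_
    exact ⟨hvar xN (by decide), hvar xM (by decide), harr⟩
  · rintro t ⟨htn, htm, harr⟩
    refine Ensures.assign (computes_denExpr hM htn htm harr) ⟨?_, ?_, ?_, harr⟩
    all_goals simp [xN, xM, xDen, htn, htm]

/-- Initially all vertices remain, with the tables of single vertices. -/
def initTables : Routine := (tabulate aAlive xPos (var xM) (lit 1)).seq (retabulate singletonExpr)

theorem ensures_initTables (hM : I.IsBound M) (hG : I.graph.Preconnected) (hs : I.Loaded s) :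
    initTables.Ensures M s (I.Contracted univ) := by
  refine Ensures.seq (Q' := fun t => I.Loaded t ∧ I.IsAlive univ t) ?_ ?_
  · refine Ensures.tabulate hs.computes_m hM.m_le (fun _ _ _ => computes_lit 1) fun a ha => ?_
    exact ⟨hs.setArr (by decide) a, fun v => by simpa using ha v v.2⟩
  · rintro t ⟨ht, halive⟩
    have hU (u : ℕ → ℕ) := ht.setArr (by decide : aNew ≠ aIn) u
    refine ensures_retabulate hM ht (t := fun v S i => if S ≠ 0 then 0 else I.weight i v + 1)
      (fun u x v hv => ?_) fun u a ha => ?_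
    · exact computes_singletonExpr hM ((hU u).setVar (by decide : 3 < xPos) x) hv
    · exact ⟨(hU u).setArr (by decide) a, halive, isTableFamily_univ hG I.commonDen_pos ha⟩

/-- All leaves are contracted one after the other, until a single vertex remains. -/
def contractAll : Routine := loop xRound (var xM - lit 1) contractLeaf

theorem ensures_contractAll (hM : I.IsBound M) (hG : I.graph.IsTree) (h : I.Contracted univ s) :
    contractAll.Ensures M s fun s' => ∃ v, I.Contracted {v} s' := by
  obtain ⟨v⟩ := hG.connected.nonempty
  have hm : 0 < I.m := v.pos
  refine Ensures.loop (fun k t => ∃ A, #A + k = I.m ∧ I.Contracted A t)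
    (h.loaded.computes_m.sub (computes_lit 1)) (by have := hM.m_le; omega)
    ⟨univ, by simp, h⟩ ?_ ?_
  · rintro k hk t ⟨A, hcard, hA⟩
    refine (ensures_contractLeaf hM hG.isAcyclic (hA.setVar (by decide) k) (by omega)).imp ?_
    rintro t' ⟨A', hcard', hA'⟩
    exact ⟨A', by omega, hA'⟩
  · rintro t ⟨A, hcard, hA⟩
    obtain ⟨v, rfl⟩ := card_eq_one.1 (by omega : #A = 1)
    exact ⟨v, hA.setVar (by decide) _⟩

/-- Whether all players can be served, according to the table of the only remaining vertex. -/
def answerExpr : Routine := servedExpr (aliveSum (var xNeighbor)) (twoPow xExp (var xN) - lit 1)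

theorem computes_answerExpr (hM : I.IsBound M) {v : Fin I.m} (h : I.Contracted {v} s) :
    answerExpr.Computes M s
      (served I.commonDen I.n (table I.n (s.arr aTable) v) (2 ^ I.n - 1)) := by
  refine computes_servedExpr hM h.loaded (fun i a => ?_) fun i a j => ?_
  · have h' := (h.setVar (by decide : 3 < xPlayer) i).setVar (by decide : 3 < xLeft) a
    simpa using computes_aliveSum hM h'.loaded h'.alive (fun _ => computes_var xNeighbor)
      fun w => (size_le_self _).trans (w.2.le.trans hM.m_le)
  · have h' := ((h.setVar (by decide : 3 < xPlayer) i).setVar (by decide : 3 < xLeft) a).setVar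
      (by decide : 3 < xBit) j
    exact (h'.loaded.computes_two_pow hM).sub (computes_lit 1)

open Classical in
theorem Contracted.served_eq {v : Fin I.m} (h : I.Contracted {v} s) :
    served I.commonDen I.n (table I.n (s.arr aTable) v) (2 ^ I.n - 1) =
      if I.HasPropAllocation then 1 else 0 := by
  have hlt (k : ℕ) := h.family.lt_served_iff (fun v => (I.weight_n v).ge) (2 ^ I.n - 1) k
  simp only [players_two_pow_sub_one, ← hasPropAllocation_iff] at hlt
  split_ifs with hI
  · exact le_antisymm (not_lt.1 fun h1 => one_ne_zero ((hlt 1).1 h1).1) ((hlt 0).2 ⟨rfl, hI⟩)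
  · exact Nat.eq_zero_of_not_pos fun h0 => hI ((hlt 0).1 h0).2

/-- The answer is computed from the input. -/
def solver : Routine :=
  readInput.seq <| initTables.seq <| contractAll.seq <| assign xOut answerExpr

open Classical in
theorem ensures_solver (hM : I.IsBound M) (hG : I.graph.IsTree) :
    solver.Ensures M (.initial I.encode) fun s =>
      s.var xOut = if I.HasPropAllocation then 1 else 0 := by
  refine (ensures_readInput hM).seq fun s hs => ?_
  refine (ensures_initTables hM hG.connected.preconnected hs).seq fun t ht => ?_
  refine (ensures_contractAll hM hG ht).seq fun u ⟨v, hu⟩ => ?_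
  refine .assign (computes_answerExpr hM hu) ?_
  simpa using hu.served_eq

end

/-! ### The running time -/

theorem isBound (I : CFD) : I.IsBound ((2 ^ I.n) ^ 2 * (inputSize I.encode + 2) ^ 2) := by
  have hlength : I.m * I.m + 2 * (I.n * I.m) ≤ inputSize I.encode := by
    refine le_trans ?_ (length_le_inputSize _)
    rw [encode_eq, List.length_cons, List.length_cons, List.length_append, length_adjacencyWord,
      length_utilityWord]
    omega
  have hm : I.m ≤ inputSize I.encode := (Nat.le_mul_self _).trans (le_self_add.trans hlength)
  have hn : I.n + 1 ≤ 2 ^ I.n := Nat.lt_two_pow_self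
  have hL : inputSize I.encode + 2 ≤ (2 ^ I.n) ^ 2 * (inputSize I.encode + 2) ^ 2 :=
    (Nat.le_pow two_pos).trans (Nat.le_mul_of_pos_left _ (by positivity))
  refine ⟨by omega, by omega, ?_, fun j => ?_⟩
  · calc (I.m + 1) * 2 ^ I.n * (I.n + 1)
        ≤ (inputSize I.encode + 2) ^ 2 * 2 ^ I.n * 2 ^ I.n := by
          gcongr
          exact le_trans (by omega) (Nat.le_pow two_pos)
      _ = _ := by ring
  · have := size_getD_le_inputSize I.encode j
    omega

end CFD

/-- Prop-CFD on trees is fixed-parameter tractable with respect to the number of players. -/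
theorem mainTheorem10 :
    RAM.IsFPT (fun I : CFD => I.graph.IsTree) CFD.encode (fun I => I.n)
      CFD.HasPropAllocation := by
  refine CFD.solver.isFPT (fun n => (2 ^ n) ^ 2) ((.X + 2) ^ 2) fun I hG => ?_
  have hM : I.IsBound
      ((2 ^ I.n) ^ 2 * ((.X + 2) ^ 2 : Polynomial ℕ).eval (RAM.inputSize I.encode)) := by
    simpa using I.isBound
  exact CFD.ensures_solver hM hG
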